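/- Let $\mathcal T$ be the set of (finite or infinite, locally finite) rooted planar trees whose root has exactly one offspring. For $T\in\mathcal T$ let $|T|$ denote the number of edges of $T$, let $h(T)$ denote its height, let $D_r(T)$ denote the set of vertices at graph distance $r$ from the root, and for $r\ge 1$ let $B_r(T)$ be the subtree spanned by the vertices at distance at most $r$ from the root; $|B_r(T)|=\sum_{s=1}^r|D_s(T)|$ is its number of edges. Equip $\mathcal T$ with the metric $\mathrm{dist}(T,T')=\inf\{1/r : r\in\mathbb N,\ r\ge 1,\ B_r(T)=B_r(T')\}$ and its Borel $\sigma$-algebra. For $\mu\in\mathbb R$ and $N\ge 1$ let $\nu^{(\mu)}_N$ be the probability measure on $\mathcal T$ that gives every tree $T$ with $|T|=N$ the mass $e^{-\mu h(T)}/Z^{(\mu)}_N$, where $Z^{(\mu)}_N=\sum_{|T|=N}e^{-\mu h(T)}$. Let $\mu>0$. Then $\nu^{(\mu)}_N$ converges weakly, as $N\to\infty$, to a Borel probability measure $\nu^{(\mu)}$ on $\mathcal T$. Let $\mathbb E_\mu$ denote the expectation with respect to $\nu^{(\mu)}$. For every $r\ge1$ the variables $|D_r|$ and $|B_r|$ are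 $\nu^{(\mu)}$-integrable, and, as $r\to\infty$ (with $\mu$ fixed), i) $\mathbb E_\mu(|D_r|)=\mu r^2\bigl(1+O(\tfrac1r)\bigr)$, ii) $\mathbb E_\mu(|B_r|)=\tfrac13\mu r^3\bigl(1+O(\tfrac1r)\bigr)$. -/

import Mathlib

open Filter Topology MeasureTheory Asymptotics

/-- A rooted planar tree whose root has exactly one offspring.
The vertices at height `r` form the ordered finite set
`D r = {0, 1, …, levelCard r - 1}` (listed from left to right), and `parent r : D (r + 1) → D r` is
the order preserving parent map. `parent r` is set to `0` outside `D (r + 1)`, so that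
two such structures are equal exactly when the trees are isomorphic through order preserving
bijections of all levels. -/
@[ext]
structure PlanarTree where
  levelCard : ℕ → ℕ
  parent : ℕ → ℕ → ℕ
  levelCard_zero : levelCard 0 = 1
  levelCard_one : levelCard 1 = 1
  parent_lt : ∀ r i, i < levelCard (r + 1) → parent r i < levelCard r
  parent_mono : ∀ r i j, i ≤ j → j < levelCard (r + 1) → parent r i ≤ parent r j
  parent_outside : ∀ r i, levelCard (r + 1) ≤ i → parent r i = 0

namespace PlanarTree

/-- The edge set `E(T)`: every vertex `(r + 1, i)` at height `r + 1` is joined to its parent. -/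
def edges (T : PlanarTree) : Set (Sym2 (ℕ × ℕ)) :=
  {e | ∃ r i, i < T.levelCard (r + 1) ∧ e = s((r + 1, i), (r, T.parent r i))}

/-- The size `|T| = |E(T)|`. -/
noncomputable def size (T : PlanarTree) : ℕ∞ := T.edges.encard

/-- The height of a tree, i.e. the supremum of the heights of its vertices
(`⊤` if and only if the tree is infinite). -/
noncomputable def height (T : PlanarTree) : ℕ∞ :=
  ⨆ r ∈ {r : ℕ | T.levelCard r ≠ 0}, (r : ℕ∞)

/-- `B_r(T)`: the subtree spanned by the vertices at height at most `r`. Only used for `r ≥ 1`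
(for `r = 0` the value is `B_1(T)`). -/
def ball (T : PlanarTree) (r : ℕ) : PlanarTree where
  levelCard s := if s ≤ max r 1 then T.levelCard s else 0
  parent s i := if s < max r 1 then T.parent s i else 0
  levelCard_zero := by simp [T.levelCard_zero]
  levelCard_one := by simp [T.levelCard_one]
  parent_lt s i h := by
    by_cases hs : s + 1 ≤ max r 1
    · rw [if_pos hs] at h
      rw [if_pos (by omega), if_pos (by omega)]
      exact T.parent_lt s i h
    · rw [if_neg hs] at h
      omega
  parent_mono s i j hij h := by
    by_cases hs : s + 1 ≤ max r 1
    · rw [if_pos hs] at h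
      rw [if_pos (by omega), if_pos (by omega)]
      exact T.parent_mono s i j hij h
    · rw [if_neg hs] at h
      omega
  parent_outside s i h := by
    by_cases hs : s + 1 ≤ max r 1
    · rw [if_pos hs] at h
      rw [if_pos (by omega)]
      exact T.parent_outside s i h
    · rw [if_neg (by omega)]

theorem ball_ball (T : PlanarTree) {r s : ℕ} (hr : r ≤ s) : (T.ball s).ball r = T.ball r := by
  ext a b
  · simp only [ball]
    split_ifs <;> first | rfl | omega
  · simp only [ball]
    split_ifs <;> first | rfl | omega

theorem ball_eq_of_le {T T' : PlanarTree} {r s : ℕ} (hr : r ≤ s) (h : T.ball s = T'.ball s) :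
    T.ball r = T'.ball r := by
  rw [← T.ball_ball hr, h, T'.ball_ball hr]

theorem eq_of_ball_eq {T T' : PlanarTree} (h : ∀ r, 1 ≤ r → T.ball r = T'.ball r) : T = T' := by
  ext a b
  · have := congrFun (congrArg levelCard (h (a + 1) (by omega))) a
    simpa [ball] using this
  · have := congrFun (congrFun (congrArg parent (h (a + 1) (by omega))) a) b
    simpa [ball] using this

/-- The set of all `1 / r`, `r ≥ 1`, such that the balls of radius `r` around the roots agree. -/
def agreement (T T' : PlanarTree) : Set ℝ :=
  {a | ∃ r : ℕ, 1 ≤ r ∧ T.ball r = T'.ball r ∧ a = 1 / (r : ℝ)}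

theorem agreement_nonneg {T T' : PlanarTree} {a : ℝ} (ha : a ∈ agreement T T') : 0 ≤ a := by
  obtain ⟨r, -, -, rfl⟩ := ha
  positivity

theorem agreement_bddBelow (T T' : PlanarTree) : BddBelow (agreement T T') :=
  ⟨0, fun _ ha => agreement_nonneg ha⟩

theorem agreement_nonempty (T T' : PlanarTree) : (agreement T T').Nonempty := by
  refine ⟨1 / ((1 : ℕ) : ℝ), 1, le_rfl, ?_, rfl⟩
  ext a b
  · simp only [ball]
    split_ifs with h
    · have : a = 0 ∨ a = 1 := by simp at h; omega
      rcases this with rfl | rfl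
      · rw [T.levelCard_zero, T'.levelCard_zero]
      · rw [T.levelCard_one, T'.levelCard_one]
    · rfl
  · simp only [ball]
    split_ifs with h
    · obtain rfl : a = 0 := by simpa using h
      have key : ∀ S : PlanarTree, S.parent 0 b = 0 := by
        intro S
        by_cases hb : b < S.levelCard (0 + 1)
        · have := S.parent_lt 0 b hb
          rw [S.levelCard_zero] at this
          omega
        · exact S.parent_outside 0 b (by omega)
      rw [key, key]
    · rfl

/-- `dist T T' = inf {1 / r | r ≥ 1, B_r(T) = B_r(T')}`. -/
noncomputable instance : MetricSpace PlanarTree where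
  dist T T' := sInf (agreement T T')
  dist_self T := by
    refine le_antisymm ?_ (Real.sInf_nonneg fun _ ha => agreement_nonneg ha)
    refine le_of_forall_pos_le_add fun ε hε => ?_
    obtain ⟨n, hn⟩ := exists_nat_one_div_lt hε
    have hmem : 1 / ((n + 1 : ℕ) : ℝ) ∈ agreement T T := ⟨n + 1, by omega, rfl, rfl⟩
    have := csInf_le (agreement_bddBelow T T) hmem
    push_cast at this
    linarith
  dist_comm T T' := by
    congr 1
    ext a
    constructor <;> rintro ⟨r, hr, h, rfl⟩ <;> exact ⟨r, hr, h.symm, rfl⟩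
  dist_triangle T T' T'' := by
    refine le_of_forall_pos_le_add fun ε hε => ?_
    obtain ⟨a, ha, ha'⟩ :=
      exists_lt_of_csInf_lt (agreement_nonempty T T') (lt_add_of_pos_right _ (half_pos hε))
    obtain ⟨b, hb, hb'⟩ :=
      exists_lt_of_csInf_lt (agreement_nonempty T' T'') (lt_add_of_pos_right _ (half_pos hε))
    have ha0 := agreement_nonneg ha
    have hb0 := agreement_nonneg hb
    obtain ⟨r, hr, h, rfl⟩ := ha
    obtain ⟨s, hs, h', rfl⟩ := hb
    rcases le_total r s with hrs | hrs
    · have := csInf_le (agreement_bddBelow T T'')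
        ⟨r, hr, h.trans (ball_eq_of_le hrs h'), rfl⟩
      linarith
    · have := csInf_le (agreement_bddBelow T T'')
        ⟨s, hs, (ball_eq_of_le hrs h).trans h', rfl⟩
      linarith
  eq_of_dist_eq_zero {T T'} h := by
    refine eq_of_ball_eq fun r hr => ?_
    have hr0 : (0 : ℝ) < 1 / (r : ℝ) := by
      have : (0 : ℝ) < r := by exact_mod_cast hr
      positivity
    obtain ⟨a, ⟨s, hs, hss, rfl⟩, hlt⟩ :=
      exists_lt_of_csInf_lt (agreement_nonempty T T') (lt_of_eq_of_lt h hr0)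
    refine ball_eq_of_le ?_ hss
    have hs0 : (0 : ℝ) < s := by exact_mod_cast hs
    have hrr : (0 : ℝ) < r := by exact_mod_cast hr
    have := (one_div_lt_one_div hs0 hrr).mp hlt
    exact le_of_lt (by exact_mod_cast this)

noncomputable instance : MeasurableSpace PlanarTree := borel PlanarTree

instance : BorelSpace PlanarTree := ⟨rfl⟩

theorem size_eq (T : PlanarTree) :
    T.size = {p : ℕ × ℕ | p.2 < T.levelCard (p.1 + 1)}.encard := by
  have himg : T.edges = (fun p : ℕ × ℕ => s((p.1 + 1, p.2), (p.1, T.parent p.1 p.2))) ''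
      {p : ℕ × ℕ | p.2 < T.levelCard (p.1 + 1)} := by
    ext e
    constructor
    · rintro ⟨r, i, h, rfl⟩
      exact ⟨(r, i), h, rfl⟩
    · rintro ⟨⟨r, i⟩, h, rfl⟩
      exact ⟨r, i, h, rfl⟩
  rw [size, himg, Set.InjOn.encard_image]
  rintro ⟨r, i⟩ - ⟨s, j⟩ - h
  simp only [Sym2.eq_iff, Prod.mk.injEq] at h
  ext <;> simp <;> omega

theorem levelCard_pos_of_le (T : PlanarTree) {r s : ℕ} (hrs : r ≤ s) (hs : 0 < T.levelCard s) :
    0 < T.levelCard r := by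
  induction s, hrs using Nat.le_induction with
  | base => exact hs
  | succ n _ ih => exact ih (lt_of_le_of_lt (Nat.zero_le _) (T.parent_lt n 0 hs))

/-- The trees of size `N`. -/
def ofSize (N : ℕ) : Set PlanarTree := {T | T.size = (N : ℕ∞)}

theorem levelCard_le_of_mem {N : ℕ} {T : PlanarTree} (hT : T ∈ ofSize N) (r : ℕ) :
    T.levelCard (r + 1) ≤ N := by
  have h : ((fun i => (r, i)) '' (Finset.range (T.levelCard (r + 1)) : Set ℕ)).encard ≤ N := by
    rw [← show T.size = (N : ℕ∞) from hT, size_eq]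
    refine Set.encard_le_encard ?_
    rintro _ ⟨i, hi, rfl⟩
    simpa using hi
  rw [Set.InjOn.encard_image (fun a _ b _ h => (Prod.mk.inj h).2), Set.encard_coe_eq_coe_finsetCard,
    Finset.card_range] at h
  exact_mod_cast h

theorem levelCard_eq_zero_of_mem {N : ℕ} {T : PlanarTree} (hT : T ∈ ofSize N) {r : ℕ}
    (hr : N < r) : T.levelCard r = 0 := by
  by_contra hne
  have h : ((fun i => (i, 0)) '' (Finset.range r : Set ℕ)).encard ≤ N := by
    rw [← show T.size = (N : ℕ∞) from hT, size_eq]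
    refine Set.encard_le_encard ?_
    rintro _ ⟨i, hi, rfl⟩
    have hi' : i < r := by simpa using hi
    exact T.levelCard_pos_of_le (Nat.succ_le_of_lt hi') (Nat.pos_of_ne_zero hne)
  rw [Set.InjOn.encard_image (fun a _ b _ h => (Prod.mk.inj h).1), Set.encard_coe_eq_coe_finsetCard,
    Finset.card_range] at h
  have : r ≤ N := by exact_mod_cast h
  omega

theorem finite_ofSize (N : ℕ) : (ofSize N).Finite := by
  let F : ofSize N → (Fin (N + 2) → Fin (N + 2)) × (Fin (N + 2) → Fin (N + 2) → Fin (N + 2)) :=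
    fun T => (fun r => Fin.ofNat (N + 2) (T.1.levelCard r),
      fun r i => Fin.ofNat (N + 2) (T.1.parent r i))
  have hle : ∀ T ∈ ofSize N, ∀ r, T.levelCard r < N + 2 := by
    intro T hT r
    cases r with
    | zero => rw [T.levelCard_zero]; omega
    | succ r => have := levelCard_le_of_mem hT r; omega
  have hpar : ∀ T ∈ ofSize N, ∀ r i, T.parent r i < N + 2 := by
    intro T hT r i
    by_cases hi : i < T.levelCard (r + 1)
    · exact (T.parent_lt r i hi).trans (hle T hT r)
    · rw [T.parent_outside r i (by omega)]; omega
  have hF : Function.Injective F := by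
    rintro ⟨T, hT⟩ ⟨T', hT'⟩ h
    have h1 := congrArg Prod.fst h
    have h2 := congrArg Prod.snd h
    refine Subtype.ext (PlanarTree.ext (funext fun r => ?_) (funext fun r => funext fun i => ?_))
    · by_cases hr : r < N + 2
      · have := congrArg Fin.val (congrFun h1 ⟨r, hr⟩)
        simpa [F, Nat.mod_eq_of_lt (hle T hT r), Nat.mod_eq_of_lt (hle T' hT' r)] using this
      · change T.levelCard r = T'.levelCard r
        rw [levelCard_eq_zero_of_mem hT (by omega), levelCard_eq_zero_of_mem hT' (by omega)]
    · change T.parent r i = T'.parent r i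
      by_cases hr : r < N + 2 ∧ i < N + 2
      · have := congrArg Fin.val (congrFun (congrFun h2 ⟨r, hr.1⟩) ⟨i, hr.2⟩)
        simpa [F, Nat.mod_eq_of_lt (hpar T hT r i), Nat.mod_eq_of_lt (hpar T' hT' r i)] using this
      · have key : ∀ S ∈ ofSize N, S.parent r i = 0 := by
          intro S hS
          refine S.parent_outside r i ?_
          by_cases hr' : r < N + 2
          · have := hle S hS (r + 1)
            have : ¬ i < N + 2 := fun hi => hr ⟨hr', hi⟩
            omega
          · rw [levelCard_eq_zero_of_mem hS (by omega)]
            omega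
        rw [key T hT, key T' hT']
  exact Set.finite_coe_iff.mp (Finite.of_injective F hF)

/-- The linear tree with `N ≥ 1` edges (for `N = 0`, with one edge). -/
def path (N : ℕ) : PlanarTree where
  levelCard r := if r ≤ max N 1 then 1 else 0
  parent _ _ := 0
  levelCard_zero := by simp
  levelCard_one := by simp
  parent_lt r i h := by split_ifs at h ⊢ <;> omega
  parent_mono _ _ _ _ _ := le_rfl
  parent_outside _ _ _ := rfl

instance : Inhabited PlanarTree := ⟨path 1⟩

theorem path_mem_ofSize {N : ℕ} (hN : 0 < N) : path N ∈ ofSize N := by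
  have h : {p : ℕ × ℕ | p.2 < (path N).levelCard (p.1 + 1)} =
      (fun i => (i, 0)) '' (Finset.range N : Set ℕ) := by
    ext ⟨r, i⟩
    simp only [path, Set.mem_ofPred_eq, Set.mem_image, Finset.coe_range, Set.mem_Iio,
      Prod.mk.injEq]
    constructor
    · intro h
      split_ifs at h with hr
      · exact ⟨r, by omega, rfl, by omega⟩
      · omega
    · rintro ⟨a, ha, rfl, rfl⟩
      rw [if_pos (by omega)]
      omega
  change (path N).size = N
  rw [size_eq, h, Set.InjOn.encard_image (fun a _ b _ h => (Prod.mk.inj h).1),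
    Set.encard_coe_eq_coe_finsetCard, Finset.card_range]

/-- The weight `exp (-μ h(T))` of a finite tree. -/
noncomputable def weight (μ : ℝ) (T : PlanarTree) : ℝ := Real.exp (-μ * (T.height.toNat : ℝ))

/-- The finite size partition function `Z_N`, the sum of the weights of all trees of size `N`. -/
noncomputable def partitionFunction (μ : ℝ) (N : ℕ) : ℝ :=
  ∑ T ∈ (finite_ofSize N).toFinset, weight μ T

theorem partitionFunction_pos (μ : ℝ) {N : ℕ} (hN : 0 < N) : 0 < partitionFunction μ N :=
  Finset.sum_pos (fun _ _ => Real.exp_pos _)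
    ⟨path N, (finite_ofSize N).mem_toFinset.mpr (path_mem_ofSize hN)⟩

/-- The measure on the space of trees giving mass `exp (-μ h(T)) / Z_N` to every tree `T` of
size `N`. -/
noncomputable def finiteSizeMeasure (μ : ℝ) (N : ℕ) : Measure PlanarTree :=
  ∑ T ∈ (finite_ofSize N).toFinset,
    ENNReal.ofReal (weight μ T / partitionFunction μ N) • Measure.dirac T

theorem isProbabilityMeasure_finiteSizeMeasure (μ : ℝ) {N : ℕ} (hN : 0 < N) :
    IsProbabilityMeasure (finiteSizeMeasure μ N) := by
  have hZ := partitionFunction_pos μ hN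
  constructor
  simp only [finiteSizeMeasure, Measure.coe_finsetSum, Finset.sum_apply, Measure.smul_apply,
    measure_univ, smul_eq_mul, mul_one]
  rw [← ENNReal.ofReal_sum_of_nonneg (fun T _ => div_nonneg (show 0 ≤ weight μ T from (Real.exp_pos _).le) hZ.le),
    ← Finset.sum_div]
  change ENNReal.ofReal (partitionFunction μ N / partitionFunction μ N) = 1
  rw [div_self hZ.ne', ENNReal.ofReal_one]

/-- The finite size probability measures `ν_N`, `N = 1, 2, 3, …`. -/
noncomputable def finiteSizeLaw (μ : ℝ) (N : ℕ+) : ProbabilityMeasure PlanarTree :=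
  ⟨finiteSizeMeasure μ N, isProbabilityMeasure_finiteSizeMeasure μ N.pos⟩

/-- The local limit of the finite size measures: their limit in the topology
of weak convergence of probability measures. -/
noncomputable def localLimit (μ : ℝ) : ProbabilityMeasure PlanarTree :=
  limUnder atTop (finiteSizeLaw μ)

end PlanarTree

/-! Tree counts with bounded height are written as exact spectral sums, limits of their ratios
follow from Laplace's method, and the limit measure is explicit enough for its mean level sizes to
be computed in closed form.

Summing a geometric series turns the weight `exp (-μ h(T))` into a sum over all height bounds `m ≥
h(T)`. The weight of the trees of size `N` with a prescribed `r`-ball, having `k ≥ 1` vertices at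
level `r`, thus becomes a constant times `∑_h exp (-μ h)` times a number of forests with `k` roots,
`n` edges and height at most `h` (`cylinderWeight_eq`). That number is `4 ^ n` times a coefficient
of `heightSeries h ^ k` (`forestCount_eq`).

Write `M = h + 2` and `s = sin² (π j / M)`. For `k = 1`, diagonalising the walk on a segment gives
the coefficient `(2 / M) ∑_j s (1 - s) ^ n`. A Riccati equation in the variable `z` reduces higher
powers to the same sum with an extra polynomial factor in `n s / M`, `s` and `1 / M`
(`exists_coeff_heightSeries_pow`). The dominant terms minimise `μ M + n s` with `s` close to `π² /
M²`, so `M` is of order `n ^ (1/3)` and `n s / M` tends to `μ / 2`, while `s` and `1 / M` tend to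
`0`. Hence the ratio of the `k`-root sum to the one-root sum tends to the polynomial factor at `(μ /
2, 0, 0)`, normalised (`tendsto_heightSum_div`), and every cylinder probability converges to
`cylinderLimit`.

Functions `k ↦ 2 ^ k ∑ β_n (k choose n + 1)` are stable under summation over one generation, which
acts on `β(x) = ∑ β_n x ^ n` as `x ↦ x + 1`. With `β(x) = exp (μ x)` the limits of the cylinder
probabilities sum to `1` (`tsum_cylinderLimit`), so no mass escapes, the laws are tight, and they
converge (`exists_tendsto_finiteSizeLaw`). The same calculus gives exactly `E |D_{R+1}| = 1 + 2 R +
μ R (R + 1)`; both asymptotic formulas are read off from it. -/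

open scoped ENNReal

namespace PlanarTree

/-! ### Generating series of forests of bounded height and a Riccati equation. -/

open PowerSeries in
/-- The generating series, in the variable `z = 4 g`, of ordered forests hanging off one vertex
with height at most `h`. -/
noncomputable def heightSeries : ℕ → PowerSeries ℝ
  | 0 => 1
  | h + 1 => (1 - C (1 / 4) * X * heightSeries h)⁻¹

section Series

open PowerSeries

theorem heightSeries_succ_mul (h : ℕ) :
    heightSeries (h + 1) * (1 - C (1 / 4) * X * heightSeries h) = 1 := by
  rw [heightSeries]
  exact PowerSeries.inv_mul_cancel _ (by simp)

/-- The series linearising the recursion: `Y_h = 1 - z C_h / 2`. -/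
noncomputable def cotSeries (h : ℕ) : PowerSeries ℝ := 1 - C (1 / 2) * X * heightSeries h

theorem cotSeries_succ_mul (h : ℕ) : (1 - cotSeries (h + 1)) * (1 + cotSeries h) = X := by
  have h1 := heightSeries_succ_mul h
  have h2 : (C (1 / 2) : PowerSeries ℝ) * 2 = 1 := by
    rw [← map_ofNat C 2, ← map_mul]; norm_num
  have h4 : (C (1 / 4) : PowerSeries ℝ) * 2 = C (1 / 2) := by
    rw [← map_ofNat C 2, ← map_mul]; norm_num
  rw [cotSeries, cotSeries]
  linear_combination (C (1 / 2) * X * 2) * h1 + X * h2 +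
    (C (1 / 2) * X ^ 2 * heightSeries h * heightSeries (h + 1)) * h4

/-- Under `z = 1 / cos² θ` the recursion is solved by `Y_h = tan θ cot ((h + 2) θ)`, and
differentiating this function of `z` gives the equation. The formal proof needs no trigonometry: it
differentiates the recursion and inducts on `h`. -/
theorem cotSeries_riccati (h : ℕ) :
    2 * X * (X - 1) * derivative ℝ (cotSeries h) =
      X * cotSeries h - ((h : PowerSeries ℝ) + 2) * (X - 1 + cotSeries h ^ 2) := by
  induction h with
  | zero =>
    have h2 : (C (1 / 2) : PowerSeries ℝ) * 2 = 1 := by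
      rw [← map_ofNat C 2, ← map_mul]; norm_num
    have hd : derivative ℝ (cotSeries 0) = -C (1 / 2) := by
      simp [cotSeries, heightSeries]
    rw [hd, cotSeries, heightSeries]
    push_cast
    linear_combination (X ^ 2 * C (1 / 2) - X) * h2
  | succ h ih =>
    have hb := cotSeries_succ_mul h
    have hd := congrArg (derivative ℝ) hb
    simp only [Derivation.leibniz, map_sub, map_add, Derivation.map_one_eq_zero, smul_eq_mul,
      derivative_X] at hd
    set a := cotSeries (h + 1)
    set b := cotSeries h
    -- The constant coefficient of `1 + b` is `2`, so its square may be cancelled; after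
    -- multiplication by it the claim is polynomial in the recursion and the induction hypothesis.
    have hne : (1 + b) ^ 2 ≠ 0 := by
      refine pow_ne_zero _ fun h0 => ?_
      have := congrArg constantCoeff h0
      simp [b, cotSeries] at this
    refine mul_right_cancel₀ hne ?_
    push_cast
    linear_combination (2 * X * (X - 1)) * (-(1 + b) * hd + derivative ℝ b * hb) + X * ih +
      (X * (1 + b) - ((h : PowerSeries ℝ) + 3) * (a * (1 + b) + (1 + b) - X)) * hb

end Series

/-! ### Spectral form of the coefficients: walks on a segment. -/

section Trig

/-- The angles `π j / (h + 2)`, `1 ≤ j ≤ h + 1`. -/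
noncomputable def angle (h j : ℕ) : ℝ := Real.pi * ((j : ℝ) + 1) / ((h : ℝ) + 2)

/-- The spectral form of the number of walks on a segment. -/
noncomputable def sineMoment (h i n : ℕ) : ℝ :=
  2 / ((h : ℝ) + 2) * ∑ j ∈ Finset.range (h + 1),
    Real.sin (angle h j) * Real.sin (i * angle h j) * Real.cos (angle h j) ^ n

theorem sineMoment_zero (h n : ℕ) : sineMoment h 0 n = 0 := by simp [sineMoment]

theorem sineMoment_top (h n : ℕ) : sineMoment h (h + 2) n = 0 := by
  rw [sineMoment, Finset.sum_eq_zero, mul_zero]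
  intro j _
  have : ((h + 2 : ℕ) : ℝ) * angle h j = ((j + 1 : ℕ) : ℝ) * Real.pi := by
    rw [angle]; push_cast; field_simp
  rw [this, Real.sin_nat_mul_pi]; ring

theorem sineMoment_succ_succ (h i n : ℕ) :
    sineMoment h (i + 1) (n + 1) = 1 / 2 * (sineMoment h i n + sineMoment h (i + 2) n) := by
  rw [sineMoment, sineMoment, sineMoment, ← mul_add, ← Finset.sum_add_distrib, mul_left_comm]
  congr 1
  rw [Finset.mul_sum]
  refine Finset.sum_congr rfl fun j _ => ?_
  have h1 : (i : ℝ) * angle h j = ((i + 1 : ℕ) : ℝ) * angle h j - angle h j := by push_cast; ring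
  have h2 : ((i + 2 : ℕ) : ℝ) * angle h j = ((i + 1 : ℕ) : ℝ) * angle h j + angle h j := by
    push_cast; ring
  rw [h1, h2, Real.sin_sub, Real.sin_add]
  ring

theorem sum_cos_angle (M k : ℕ) (hk : 0 < k) (hkM : k < 2 * M) :
    ∑ j ∈ Finset.range M, Real.cos (k * (Real.pi * j / M)) = (1 - (-1) ^ k) / 2 := by
  have hM : (0 : ℝ) < M := by
    have : 0 < M := by omega
    exact_mod_cast this
  set a : ℝ := k * Real.pi / (2 * M) with ha
  have hsin : 0 < Real.sin a := by
    have hk' : (0 : ℝ) < k := by exact_mod_cast hk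
    have hkM' : (k : ℝ) < 2 * M := by exact_mod_cast hkM
    refine Real.sin_pos_of_pos_of_lt_pi (by positivity) ?_
    rw [ha, div_lt_iff₀ (by positivity)]
    nlinarith [Real.pi_pos]
  -- Multiplied by `2 sin a`, with `a` half the angular step, the cosine sum telescopes.
  have key : ∀ n : ℕ, 2 * Real.sin a * ∑ j ∈ Finset.range n, Real.cos (k * (Real.pi * j / M)) =
      Real.sin (2 * n * a - a) + Real.sin a := by
    intro n
    induction n with
    | zero => simp
    | succ n ih =>
      rw [Finset.sum_range_succ, mul_add, ih]
      have h1 : (k : ℝ) * (Real.pi * n / M) = 2 * n * a := by rw [ha]; field_simp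
      have h2 : 2 * ((n + 1 : ℕ) : ℝ) * a - a = 2 * n * a + a := by push_cast; ring
      rw [h1, h2, Real.sin_add, Real.sin_sub]
      ring
  have h1 := key M
  have h2 : 2 * (M : ℝ) * a - a = (k : ℝ) * Real.pi - a := by rw [ha]; field_simp
  rw [h2, Real.sin_sub, Real.sin_nat_mul_pi, Real.cos_nat_mul_pi] at h1
  have h3 : 2 * Real.sin a ≠ 0 := by positivity
  refine mul_left_cancel₀ h3 ?_
  rw [h1]; ring

/-- Orthogonality of the sine eigenvectors. The product of sines is a difference of cosines of
frequencies `i` and `i + 2`, whose sums agree by parity except when `i = 0`. -/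
theorem sineMoment_succ_zero (h i : ℕ) (hi : i < h + 1) :
    sineMoment h (i + 1) 0 = if i = 0 then 1 else 0 := by
  have hM : ((h : ℝ) + 2) ≠ 0 := by positivity
  have h1 : sineMoment h (i + 1) 0 = 1 / ((h : ℝ) + 2) *
      (∑ j ∈ Finset.range (h + 2), Real.cos (i * (Real.pi * j / ((h + 2 : ℕ) : ℝ))) -
        ∑ j ∈ Finset.range (h + 2),
          Real.cos ((i + 2 : ℕ) * (Real.pi * j / ((h + 2 : ℕ) : ℝ)))) := by
    rw [sineMoment, ← Finset.sum_sub_distrib, Finset.sum_range_succ' _ (h + 1)]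
    simp only [Nat.cast_zero, mul_zero, zero_div, Real.cos_zero, sub_self, add_zero]
    rw [div_eq_mul_one_div, mul_assoc, mul_left_comm, Finset.mul_sum]
    congr 1
    refine Finset.sum_congr rfl fun j _ => ?_
    have e1 : (i : ℝ) * (Real.pi * ((j + 1 : ℕ) : ℝ) / ((h + 2 : ℕ) : ℝ)) =
      ((i + 1 : ℕ) : ℝ) * angle h j - angle h j := by rw [angle]; push_cast; ring
    have e2 : ((i + 2 : ℕ) : ℝ) * (Real.pi * ((j + 1 : ℕ) : ℝ) / ((h + 2 : ℕ) : ℝ)) =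
      ((i + 1 : ℕ) : ℝ) * angle h j + angle h j := by rw [angle]; push_cast; ring
    rw [e1, e2, Real.cos_sub, Real.cos_add]
    ring
  rw [h1, sum_cos_angle (h + 2) (i + 2) (by omega) (by omega)]
  split_ifs with h0
  · subst h0
    simp
    field_simp
  · rw [sum_cos_angle (h + 2) i (by omega) (by omega), pow_add]
    simp

/-- `n` steps starting at vertex `1` cannot reach vertex `i`. -/
theorem sineMoment_eq_zero (h n i : ℕ) (hi : i ≤ h + 2) (hn : n + 1 < i) :
    sineMoment h i n = 0 := by
  induction n generalizing i with
  | zero =>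
    obtain ⟨i, rfl⟩ : ∃ k, i = k + 1 := ⟨i - 1, by omega⟩
    rcases Nat.lt_or_ge i (h + 1) with hlt | hge
    · rw [sineMoment_succ_zero h i hlt, if_neg (by omega)]
    · obtain rfl : i = h + 1 := by omega
      exact sineMoment_top h 0
  | succ n ih =>
    obtain ⟨i, rfl⟩ : ∃ k, i = k + 1 := ⟨i - 1, by omega⟩
    rcases Nat.lt_or_ge i (h + 1) with hlt | hge
    · rw [sineMoment_succ_succ, ih i (by omega) (by omega), ih (i + 2) (by omega) (by omega)]
      simp
    · obtain rfl : i = h + 1 := by omega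
      exact sineMoment_top h _

open PowerSeries

/-- The walk series ending at the `i`-th vertex. -/
noncomputable def walkSeries (h i : ℕ) : PowerSeries ℝ :=
  PowerSeries.mk fun n => sineMoment h (i + 1) (2 * n + i)

theorem walkSeries_zero (h : ℕ) : walkSeries h 0 = 1 + C (1 / 2) * X * walkSeries h 1 := by
  ext n
  cases n with
  | zero =>
    simp [walkSeries, mul_assoc]
    simpa using sineMoment_succ_zero h 0 (by omega)
  | succ n =>
    rw [map_add, mul_assoc, coeff_C_mul, coeff_succ_X_mul, coeff_one, if_neg (by omega)]
    simp only [walkSeries, coeff_mk]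
    rw [show 2 * (n + 1) + 0 = (2 * n + 1) + 1 by ring, sineMoment_succ_succ, sineMoment_zero]
    simp

theorem walkSeries_succ (h i : ℕ) (hi : i + 1 ≤ h) :
    walkSeries h (i + 1) = C (1 / 2) * (walkSeries h i + X * walkSeries h (i + 2)) := by
  ext n
  rw [coeff_C_mul, map_add]
  cases n with
  | zero =>
    simp only [walkSeries, coeff_mk, coeff_zero_X_mul]
    rw [show 2 * 0 + (i + 1) = (2 * 0 + i) + 1 by ring, sineMoment_succ_succ,
      sineMoment_eq_zero h (2 * 0 + i) (i + 1 + 2) (by omega) (by omega)]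
  | succ n =>
    rw [coeff_succ_X_mul]
    simp only [walkSeries, coeff_mk]
    rw [show 2 * (n + 1) + (i + 1) = (2 * (n + 1) + i) + 1 by ring, sineMoment_succ_succ]
    ring_nf

theorem walkSeries_top (h : ℕ) : walkSeries h (h + 1) = 0 := by
  ext n
  simp [walkSeries, sineMoment_top]

/-- The three-term recursion is solved from the far end of the segment, where the boundary value is
zero; the successive ratios obey the recursion of `heightSeries`. Here `d` measures the distance to
that end, hence the induction on `d`. -/
theorem walkSeries_eq_mul (h d i : ℕ) (hd : i + 1 + d = h) :
    walkSeries h (i + 1) = C (1 / 2) * heightSeries d * walkSeries h i := by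
  induction d generalizing i with
  | zero =>
    rw [walkSeries_succ h i (by omega)]
    obtain rfl : h = i + 1 := by omega
    rw [walkSeries_top, heightSeries]
    ring
  | succ d ih =>
    have h1 := walkSeries_succ h i (by omega)
    have h2 := ih (i + 1) (by omega)
    have h3 := heightSeries_succ_mul d
    have h4 : (C (1 / 2) : PowerSeries ℝ) * C (1 / 2) = C (1 / 4) := by
      rw [← map_mul]; norm_num
    rw [h2] at h1
    linear_combination (heightSeries (d + 1)) * h1 - (walkSeries h (i + 1)) * h3 +
      (heightSeries (d + 1) * X * heightSeries d * walkSeries h (i + 1)) * h4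

theorem walkSeries_zero_eq (h : ℕ) : walkSeries h 0 = heightSeries h := by
  have h1 := walkSeries_zero h
  cases h with
  | zero => rw [h1, walkSeries_top, heightSeries]; ring
  | succ h =>
    have h2 := walkSeries_eq_mul (h + 1) h 0 (by omega)
    have h3 := heightSeries_succ_mul h
    have h4 : (C (1 / 2) : PowerSeries ℝ) * C (1 / 2) = C (1 / 4) := by
      rw [← map_mul]; norm_num
    rw [h2] at h1
    linear_combination (heightSeries (h + 1)) * h1 - (walkSeries (h + 1) 0) * h3 +
      (heightSeries (h + 1) * X * heightSeries h * walkSeries (h + 1) 0) * h4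

/-- The squared sines of the angles. -/
noncomputable def sinSq (h j : ℕ) : ℝ := Real.sin (angle h j) ^ 2

theorem coeff_heightSeries (h n : ℕ) :
    coeff n (heightSeries h) = 2 / ((h : ℝ) + 2) * ∑ j ∈ Finset.range (h + 1),
      sinSq h j * (1 - sinSq h j) ^ n := by
  rw [← walkSeries_zero_eq, walkSeries, coeff_mk, sineMoment]
  congr 1
  refine Finset.sum_congr rfl fun j _ => ?_
  rw [sinSq, ← Real.cos_sq', ← pow_mul]
  push_cast
  ring_nf

theorem coeff_succ_cotSeries (h n : ℕ) :
    coeff (n + 1) (cotSeries h) = -(1 / ((h : ℝ) + 2)) * ∑ j ∈ Finset.range (h + 1),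
      sinSq h j * (1 - sinSq h j) ^ n := by
  rw [cotSeries, map_sub, mul_assoc, coeff_C_mul, coeff_succ_X_mul, coeff_heightSeries, coeff_one,
    if_neg (by omega)]
  ring

/-- The Riccati equation times `Y ^ k`, solved for `Y ^ (k + 2)`, with `Y ^ k Y'` written as a
derivative of `Y ^ (k + 1)`. It lowers powers at the price of operators acting simply on
coefficients. -/
theorem cotSeries_pow_succ_succ (h k : ℕ) :
    cotSeries h ^ (k + 2) = (1 - X) * cotSeries h ^ k + C (1 / ((h : ℝ) + 2)) *
      (X * cotSeries h ^ (k + 1) +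
        C (2 / ((k : ℝ) + 1)) * (X * (1 - X) * derivative ℝ (cotSeries h ^ (k + 1)))) := by
  have h1 := cotSeries_riccati h
  have h2 : (C (1 / ((h : ℝ) + 2)) : PowerSeries ℝ) * ((h : PowerSeries ℝ) + 2) = 1 := by
    rw [show ((h : PowerSeries ℝ) + 2) = C ((h : ℝ) + 2) by
      rw [map_add, map_natCast, map_ofNat], ← map_mul, one_div,
      inv_mul_cancel₀ (by positivity), map_one]
  have h3 : (C (2 / ((k : ℝ) + 1)) : PowerSeries ℝ) * ((k : PowerSeries ℝ) + 1) = 2 := by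
    rw [show ((k : PowerSeries ℝ) + 1) = C ((k : ℝ) + 1) by simp, ← map_mul,
      div_mul_cancel₀ _ (by positivity), map_ofNat]
  rw [Derivation.leibniz_pow]
  simp only [Nat.add_sub_cancel, smul_eq_mul, nsmul_eq_mul]
  push_cast
  linear_combination (-(C (1 / ((h : ℝ) + 2)) * X * (1 - X) * cotSeries h ^ k *
      derivative ℝ (cotSeries h))) * h3 + C (1 / ((h : ℝ) + 2)) * cotSeries h ^ k * h1 -
    cotSeries h ^ k * (X - 1 + cotSeries h ^ 2) * h2

end Trig

/-! ### Coefficients of powers as spectral sums with polynomial factors. -/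

/-- The polynomials in the spectral form of the coefficients of powers of `cotSeries`. -/
noncomputable def spectralPoly : ℕ → ℝ → ℝ → ℝ → ℝ
  | 0, _, _, _ => 0
  | 1, _, _, _ => 1
  | k + 2, x, s, v => (1 - s) ^ 2 * spectralPoly k x s v - (1 - s) * spectralPoly k (x - 1) s v +
      v * (spectralPoly (k + 1) (x - 1) s v + 2 / ((k : ℝ) + 1) *
        (x * (1 - s) * spectralPoly (k + 1) x s v -
          (x - 1) * spectralPoly (k + 1) (x - 1) s v))

open PowerSeries in
theorem coeff_X_mul_one_sub_X_mul_derivative (f : PowerSeries ℝ) (m : ℕ) :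
    coeff (m + 1) (X * (1 - X) * derivative ℝ f) =
      ((m : ℝ) + 1) * coeff (m + 1) f - m * coeff m f := by
  rw [mul_assoc, coeff_succ_X_mul, sub_mul, one_mul, map_sub, coeff_derivative]
  cases m with
  | zero => simp
  | succ m => rw [coeff_succ_X_mul, coeff_derivative]; push_cast; ring

open PowerSeries in
theorem coeff_cotSeries_pow (h k n : ℕ) (hn : 1 ≤ n) (hk : k ≤ n) :
    coeff n (cotSeries h ^ k) = -(1 / ((h : ℝ) + 2)) * ∑ j ∈ Finset.range (h + 1),
      sinSq h j * (1 - sinSq h j) ^ (n - k) * spectralPoly k n (sinSq h j) (1 / ((h : ℝ) + 2)) := by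
  induction k using Nat.twoStepInduction generalizing n with
  | zero => simp [spectralPoly, coeff_one, show n ≠ 0 by omega]
  | one =>
    obtain ⟨m, rfl⟩ : ∃ m, n = m + 1 := ⟨n - 1, by omega⟩
    simp [spectralPoly, coeff_succ_cotSeries]
  | more k ih0 ih1 =>
    obtain ⟨m, rfl⟩ : ∃ m, n = m + 1 := ⟨n - 1, by omega⟩
    rw [cotSeries_pow_succ_succ, map_add, coeff_C_mul, map_add, coeff_C_mul,
      coeff_X_mul_one_sub_X_mul_derivative, coeff_succ_X_mul, sub_mul, one_mul, map_sub,
      coeff_succ_X_mul, ih0 (m + 1) (by omega) (by omega), ih0 m (by omega) (by omega),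
      ih1 (m + 1) (by omega) (by omega), ih1 m (by omega) (by omega)]
    simp only [Finset.mul_sum, ← Finset.sum_sub_distrib, ← Finset.sum_add_distrib]
    refine Finset.sum_congr rfl fun j _ => ?_
    have e1 : m + 1 - k = (m + 1 - (k + 2)) + 2 := by omega
    have e2 : m - k = (m + 1 - (k + 2)) + 1 := by omega
    have e3 : m + 1 - (k + 1) = (m + 1 - (k + 2)) + 1 := by omega
    have e4 : m - (k + 1) = m + 1 - (k + 2) := by omega
    rw [e1, e2, e3, e4, spectralPoly]
    push_cast
    rw [add_sub_cancel_right]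
    ring

/-- In terms of `V = x s v`, replacing `x` by `x - 1` shifts `V` by `s v`, so a difference quotient
in `V` is again a polynomial. This absorbs the factor `x` in the recursion of `spectralPoly`, since
`x * (s * v) = V`. -/
theorem exists_eval_sub_eval_shift (R : MvPolynomial (Fin 3) ℝ) :
    ∃ D : MvPolynomial (Fin 3) ℝ, ∀ V s v : ℝ,
      MvPolynomial.eval ![V, s, v] R - MvPolynomial.eval ![V - s * v, s, v] R =
        s * v * MvPolynomial.eval ![V, s, v] D := by
  induction R using MvPolynomial.induction_on with
  | C a => exact ⟨0, fun V s v => by simp⟩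
  | add p q hp hq =>
    obtain ⟨D, hD⟩ := hp
    obtain ⟨E, hE⟩ := hq
    refine ⟨D + E, fun V s v => ?_⟩
    rw [map_add, map_add, map_add, mul_add, ← hD, ← hE]
    ring
  | mul_X p i hp =>
    obtain ⟨D, hD⟩ := hp
    have hX : ∃ e : ℝ, ∀ V s v : ℝ,
        (![V - s * v, s, v] : Fin 3 → ℝ) i = (![V, s, v] : Fin 3 → ℝ) i - s * v * e := by
      fin_cases i
      · exact ⟨1, fun V s v => by simp⟩
      · exact ⟨0, fun V s v => by simp⟩
      · exact ⟨0, fun V s v => by simp⟩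
    obtain ⟨e, he⟩ := hX
    refine ⟨D * MvPolynomial.X i + (p - MvPolynomial.X 1 * MvPolynomial.X 2 * D) *
      MvPolynomial.C e, fun V s v => ?_⟩
    have h1 := hD V s v
    simp only [map_mul, map_add, map_sub, MvPolynomial.eval_X, MvPolynomial.eval_C, he]
    simp only [Matrix.cons_val_one, Matrix.cons_val_zero, Matrix.cons_val]
    linear_combination ((![V, s, v] : Fin 3 → ℝ) i - s * v * e) * h1

/-- At `s = v = 0` the two terms of index `k` cancel and the recursion reduces to multiplication of
the polynomial of index `k + 1` by `-2 κ / (k + 1)`, whence the power over a factorial. -/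
theorem exists_spectralPoly_eq_eval (k : ℕ) :
    (∃ R : MvPolynomial (Fin 3) ℝ,
      (∀ x s v : ℝ, spectralPoly k x s v = MvPolynomial.eval ![x * s * v, s, v] R) ∧
      ∀ κ : ℝ, MvPolynomial.eval ![κ, 0, 0] R =
        if k = 0 then 0 else (-2 * κ) ^ (k - 1) / ((k - 1).factorial : ℝ)) := by
  induction k using Nat.twoStepInduction with
  | zero => exact ⟨0, by simp [spectralPoly], by simp⟩
  | one => exact ⟨1, by simp [spectralPoly], by simp⟩
  | more k ih0 ih1 =>
    obtain ⟨R, hR, hR0⟩ := ih0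
    obtain ⟨S, hS, hS0⟩ := ih1
    obtain ⟨D, hD⟩ := exists_eval_sub_eval_shift R
    obtain ⟨E, hE⟩ := exists_eval_sub_eval_shift S
    let X1 : MvPolynomial (Fin 3) ℝ := MvPolynomial.X 1
    let X2 : MvPolynomial (Fin 3) ℝ := MvPolynomial.X 2
    refine ⟨(1 - X1) ^ 2 * R - (1 - X1) * (R - X1 * X2 * D) + X2 * (S - X1 * X2 * E) +
      MvPolynomial.C (2 / ((k : ℝ) + 1)) *
        (MvPolynomial.X 0 * (X2 * E - S) + X2 * (S - X1 * X2 * E)), ?_, ?_⟩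
    · intro x s v
      have h1 := hD (x * s * v) s v
      have h2 := hE (x * s * v) s v
      have e : x * s * v - s * v = (x - 1) * s * v := by ring
      rw [e] at h1 h2
      rw [spectralPoly, hR, hR, hS, hS]
      simp only [map_mul, map_add, map_sub, map_pow, map_one, MvPolynomial.eval_X,
        MvPolynomial.eval_C, X1, X2, Matrix.cons_val_one, Matrix.cons_val_zero, Matrix.cons_val]
      linear_combination (1 - s) * h1 - v * h2 + v * 2 / ((k : ℝ) + 1) * (x - 1) * h2
    · intro κ
      simp only [map_mul, map_add, map_sub, map_pow, map_one, MvPolynomial.eval_X,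
        MvPolynomial.eval_C, X1, X2, Matrix.cons_val_one, Matrix.cons_val_zero, Matrix.cons_val,
        hS0]
      simp only [Nat.add_eq_zero_iff, one_ne_zero, and_false, if_false,
        show k + 2 - 1 = k + 1 by omega, Nat.add_sub_cancel, OfNat.ofNat_ne_zero]
      rw [Nat.factorial_succ]
      push_cast
      have : ((k.factorial : ℕ) : ℝ) ≠ 0 := by positivity
      field_simp
      ring

-- From `z ^ k C_h ^ k = 2 ^ k (1 - Y_h) ^ k` and the binomial theorem. The value at `(κ, 0, 0)` is,
-- up to the factor `2 ^ k`, a Laguerre polynomial of degree `k - 1` and parameter `1` at `-2 κ`.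
open PowerSeries in
theorem exists_coeff_heightSeries_pow (k : ℕ) (hk : 1 ≤ k) :
    ∃ R : MvPolynomial (Fin 3) ℝ,
      (∀ h n : ℕ, coeff n (heightSeries h ^ k) = 1 / ((h : ℝ) + 2) *
        ∑ j ∈ Finset.range (h + 1), sinSq h j * (1 - sinSq h j) ^ n *
          MvPolynomial.eval ![((n : ℝ) + k) * sinSq h j * (1 / ((h : ℝ) + 2)), sinSq h j,
            1 / ((h : ℝ) + 2)] R) ∧
      ∀ κ : ℝ, MvPolynomial.eval ![κ, 0, 0] R =
        2 ^ k * ∑ i ∈ Finset.range k, (k.choose (i + 1) : ℝ) * (2 * κ) ^ i / (i.factorial : ℝ) := by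
  choose Q hQ hQ0 using exists_spectralPoly_eq_eval
  refine ⟨MvPolynomial.C (2 ^ k) * ∑ i ∈ Finset.range (k + 1),
    MvPolynomial.C ((k.choose i : ℝ) * (-1) ^ (i + 1)) * (1 - MvPolynomial.X 1) ^ (k - i) * Q i,
    ?_, ?_⟩
  · intro h n
    have h2 : (C 2 : PowerSeries ℝ) * C (1 / 2) = 1 := by
      rw [← map_mul]; norm_num
    have h1 : X ^ k * heightSeries h ^ k = C (2 ^ k) * (-cotSeries h + 1) ^ k := by
      rw [map_pow, ← mul_pow, ← mul_pow, cotSeries]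
      congr 1
      linear_combination (-X * heightSeries h) * h2
    -- The factor `X ^ k` moves the coefficient to order `n + k`. This order is at least `1` and at
    -- least every exponent `i ≤ k`, as `coeff_cotSeries_pow` requires.
    have h3 := congrArg (coeff (n + k)) h1
    rw [coeff_X_pow_mul, coeff_C_mul, add_pow, map_sum] at h3
    rw [h3]
    have h4 : ∀ i ∈ Finset.range (k + 1),
        coeff (n + k) ((-cotSeries h) ^ i * 1 ^ (k - i) * (k.choose i : PowerSeries ℝ)) =
        (k.choose i : ℝ) * (-1) ^ i * (-(1 / ((h : ℝ) + 2)) * ∑ j ∈ Finset.range (h + 1),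
          sinSq h j * (1 - sinSq h j) ^ (n + k - i) *
            spectralPoly i (n + k : ℕ) (sinSq h j) (1 / ((h : ℝ) + 2))) := by
      intro i hi
      have hi' : i ≤ k := by simpa [Nat.lt_succ_iff] using hi
      rw [← coeff_cotSeries_pow h i (n + k) (by omega) (by omega), neg_pow, one_pow, mul_one,
        ← coeff_C_mul]
      congr 1
      simp
      ring
    rw [Finset.sum_congr rfl h4]
    simp only [map_mul, map_sum, map_sub, map_pow, map_one, MvPolynomial.eval_X,
        MvPolynomial.eval_C, Matrix.cons_val_one, Matrix.cons_val_zero]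
    simp only [Finset.mul_sum]
    rw [Finset.sum_comm]
    refine Finset.sum_congr rfl fun j _ => Finset.sum_congr rfl fun i hi => ?_
    have hi' : i ≤ k := by simpa [Nat.lt_succ_iff] using hi
    rw [hQ, show n + k - i = n + (k - i) by omega, pow_add]
    push_cast
    ring
  · intro κ
    simp only [map_mul, map_sum, map_sub, map_pow, map_one, MvPolynomial.eval_X,
        MvPolynomial.eval_C, Matrix.cons_val_one, Matrix.cons_val_zero, hQ0]
    congr 1
    rw [Finset.sum_range_succ']
    simp only [Nat.add_eq_zero_iff, one_ne_zero, and_false, if_false, if_true, mul_zero, add_zero,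
      sub_zero, one_pow, mul_one, Nat.add_sub_cancel]
    refine Finset.sum_congr rfl fun i _ => ?_
    rw [show (-2 * κ : ℝ) = -1 * (2 * κ) by ring, mul_pow, pow_add, pow_add]
    have h1 : ((-1 : ℝ) ^ i) * (-1) ^ i = 1 := by rw [← mul_pow]; simp
    linear_combination ((k.choose (i + 1) : ℝ) * (2 * κ) ^ i / (i.factorial : ℝ)) * h1

/-! ### Laplace's method for the sums over all heights. -/

/-- The index set of the spectral decompositions of all the segments. -/
abbrev SpectralIndex := Σ h : ℕ, Fin (h + 1)

/-- The squared sine attached to an index. -/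
noncomputable def SpectralIndex.sq (i : SpectralIndex) : ℝ := sinSq i.1 i.2

/-- The length of the segment attached to an index. -/
noncomputable def SpectralIndex.len (i : SpectralIndex) : ℝ := (i.1 : ℝ) + 2

/-- The weight of an index in the spectral sum of order `n`. -/
noncomputable def spectralWeight (μ : ℝ) (n : ℕ) (i : SpectralIndex) : ℝ :=
  Real.exp (-μ * i.1) * (1 / i.len) * (i.sq * (1 - i.sq) ^ n)

theorem SpectralIndex.two_le_len (i : SpectralIndex) : 2 ≤ i.len := by
  rw [SpectralIndex.len]; linarith [Nat.cast_nonneg (α := ℝ) i.1]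

theorem SpectralIndex.len_pos (i : SpectralIndex) : 0 < i.len := by
  linarith [i.two_le_len]

theorem SpectralIndex.sq_nonneg (i : SpectralIndex) : 0 ≤ i.sq := _root_.sq_nonneg _

theorem SpectralIndex.sq_le_one (i : SpectralIndex) : i.sq ≤ 1 := Real.sin_sq_le_one _

/-- All angles lie between `π / M` and `π - π / M`, and the sine is symmetric about `π / 2`. -/
theorem sin_pi_div_le_sin_angle (i : SpectralIndex) :
    Real.sin (Real.pi / i.len) ≤ Real.sin (angle i.1 i.2) := by
  have hM := i.len_pos
  have hM2 := i.two_le_len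
  have hj : ((i.2 : ℕ) : ℝ) + 1 ≤ i.len - 1 := by
    have : (i.2 : ℕ) + 1 ≤ i.1 + 1 := i.2.2
    have : ((i.2 : ℕ) : ℝ) + 1 ≤ (i.1 : ℝ) + 1 := by exact_mod_cast this
    rw [SpectralIndex.len]; linarith
  have hj0 : (0 : ℝ) ≤ ((i.2 : ℕ) : ℝ) := Nat.cast_nonneg _
  have hpi := Real.pi_pos
  have hx : Real.pi / i.len ≤ Real.pi / 2 := by gcongr
  have ha : angle i.1 i.2 = Real.pi * (((i.2 : ℕ) : ℝ) + 1) / i.len := rfl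
  have h1 : Real.pi / i.len ≤ angle i.1 i.2 := by
    rw [ha]; gcongr; nlinarith
  have h2 : angle i.1 i.2 ≤ Real.pi - Real.pi / i.len := by
    rw [ha, div_le_iff₀ hM, sub_mul, div_mul_cancel₀ _ hM.ne']
    nlinarith
  have hpos : 0 ≤ Real.pi / i.len := by positivity
  rcases le_total (angle i.1 i.2) (Real.pi / 2) with h | h
  · exact Real.sin_le_sin_of_le_of_le_pi_div_two (by linarith) h h1
  · rw [← Real.sin_pi_sub (angle i.1 i.2)]
    exact Real.sin_le_sin_of_le_of_le_pi_div_two (by linarith) (by linarith) (by linarith)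

theorem sin_pi_div_sq_le_sq (i : SpectralIndex) : Real.sin (Real.pi / i.len) ^ 2 ≤ i.sq := by
  have hM2 := i.two_le_len
  refine pow_le_pow_left₀ (Real.sin_nonneg_of_nonneg_of_le_pi (by positivity) ?_)
    (sin_pi_div_le_sin_angle i) 2
  exact div_le_self Real.pi_pos.le (by linarith)

theorem two_div_le_sin_pi_div {M : ℝ} (hM : 2 ≤ M) : 2 / M ≤ Real.sin (Real.pi / M) := by
  have hpi := Real.pi_pos
  have h := Real.mul_le_sin (x := Real.pi / M) (by positivity) (by gcongr)
  refine le_trans (le_of_eq ?_) h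
  field_simp

theorem four_div_le_sq (i : SpectralIndex) : 4 / i.len ^ 2 ≤ i.sq := by
  refine le_trans ?_ (sin_pi_div_sq_le_sq i)
  have hM := i.len_pos
  calc 4 / i.len ^ 2 = (2 / i.len) ^ 2 := by ring
    _ ≤ _ := pow_le_pow_left₀ (by positivity) (two_div_le_sin_pi_div i.two_le_len) 2

theorem spectralWeight_nonneg (μ : ℝ) (n : ℕ) (i : SpectralIndex) : 0 ≤ spectralWeight μ n i := by
  have h1 := i.sq_nonneg
  have h2 := i.len_pos
  have h3 : 0 ≤ 1 - i.sq := by linarith [i.sq_le_one]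
  rw [spectralWeight]
  positivity

/-- The energy of an index. -/
noncomputable def SpectralIndex.energy (μ : ℝ) (n : ℕ) (i : SpectralIndex) : ℝ :=
  μ * i.len + n * i.sq

theorem spectralWeight_le (μ : ℝ) (n : ℕ) (i : SpectralIndex) :
    spectralWeight μ n i ≤ Real.exp (2 * μ) * Real.exp (-i.energy μ n) := by
  have h1 := i.sq_nonneg
  have h2 := i.two_le_len
  have h3 : 0 ≤ 1 - i.sq := by linarith [i.sq_le_one]
  have h4 : (1 - i.sq) ^ n ≤ Real.exp (-(n * i.sq)) := by
    have h5 : 1 - i.sq ≤ Real.exp (-i.sq) := by linarith [Real.add_one_le_exp (-i.sq)]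
    calc (1 - i.sq) ^ n ≤ Real.exp (-i.sq) ^ n := pow_le_pow_left₀ h3 h5 n
      _ = _ := by rw [← Real.exp_nat_mul]; ring_nf
  have h5 : 1 / i.len ≤ 1 := by
    rw [div_le_one (by linarith)]; linarith
  have h6 : Real.exp (2 * μ) * Real.exp (-i.energy μ n) =
      Real.exp (-μ * i.1) * Real.exp (-(n * i.sq)) := by
    rw [← Real.exp_add, ← Real.exp_add, SpectralIndex.energy, SpectralIndex.len]
    ring_nf
  rw [h6, spectralWeight]
  have h7 : i.sq * (1 - i.sq) ^ n ≤ 1 * Real.exp (-(n * i.sq)) :=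
    mul_le_mul i.sq_le_one h4 (by positivity) (by norm_num)
  calc _ ≤ Real.exp (-μ * i.1) * 1 * (1 * Real.exp (-(n * i.sq))) := by gcongr
    _ = _ := by ring

/-- The position of the saddle point. -/
noncomputable def saddle (μ : ℝ) : ℝ := (Real.pi ^ 2 / (μ / 2)) ^ (1 / 3 : ℝ)

theorem saddle_pos {μ : ℝ} (hμ : 0 < μ) : 0 < saddle μ := by
  have := Real.pi_pos
  exact Real.rpow_pos_of_pos (by positivity) _

theorem rpow_third_pow {x : ℝ} (hx : 0 ≤ x) : (x ^ (1 / 3 : ℝ)) ^ 3 = x := by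
  rw [← Real.rpow_natCast, ← Real.rpow_mul hx]; norm_num

theorem saddle_pow {μ : ℝ} (hμ : 0 < μ) : saddle μ ^ 3 = Real.pi ^ 2 / (μ / 2) :=
  rpow_third_pow (by positivity)

/-- The minimal energy per unit. -/
noncomputable def minEnergy (μ : ℝ) : ℝ := 3 * (μ / 2) * saddle μ

theorem minEnergy_pos {μ : ℝ} (hμ : 0 < μ) : 0 < minEnergy μ := by
  have := saddle_pos hμ
  rw [minEnergy]; positivity

theorem tendsto_cbrt : Tendsto (fun n : ℕ => (n : ℝ) ^ (1 / 3 : ℝ)) atTop atTop :=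
  (tendsto_rpow_atTop (by norm_num)).comp tendsto_natCast_atTop_atTop

/-- Quantitative form of the inequality between the arithmetic and the geometric mean. -/
theorem amgm_gap {κ δ V y P : ℝ} (hκ : 0 < κ) (hδ : 0 < δ) (hV : 0 ≤ V) (hy : 0 < y)
    (hP : P ≤ y ^ 3 * V) (hdist : δ ≤ |V - κ|) :
    27 * κ ^ 2 * P ≤ (1 - (δ / (3 * κ + δ)) ^ 2) * (y * (V + 2 * κ)) ^ 3 := by
  set ρ := δ / (3 * κ + δ) with hρ
  have hρ0 : 0 ≤ ρ := by positivity
  -- `ρ` is the value of `|V - κ| / (V + 2 κ)` at `V = κ + δ`, its smallest value at distance at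
  -- least `δ` from `κ`.
  have h1 : ρ * (V + 2 * κ) ≤ |V - κ| := by
    rw [hρ, div_mul_eq_mul_div, div_le_iff₀ (by positivity)]
    rcases le_abs'.mp hdist with h | h
    · rw [abs_of_nonpos (by linarith)]; nlinarith
    · rw [abs_of_nonneg (by linarith)]; nlinarith
  have h2 : (ρ * (V + 2 * κ)) ^ 2 ≤ (V - κ) ^ 2 := by
    rw [← sq_abs (V - κ)]
    exact pow_le_pow_left₀ (by positivity) h1 2
  have h3 : (ρ * (V + 2 * κ)) ^ 2 * (V + 2 * κ) ≤ (V - κ) ^ 2 * (V + 8 * κ) :=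
    mul_le_mul h2 (by linarith) (by positivity) (by positivity)
  -- Rests on `(V + 2 κ) ^ 3 - 27 κ ^ 2 V = (V - κ) ^ 2 (V + 8 κ)`.
  have h4 : 27 * κ ^ 2 * V ≤ (1 - ρ ^ 2) * (V + 2 * κ) ^ 3 := by nlinarith
  calc 27 * κ ^ 2 * P ≤ 27 * κ ^ 2 * (y ^ 3 * V) := by gcongr
    _ = y ^ 3 * (27 * κ ^ 2 * V) := by ring
    _ ≤ y ^ 3 * ((1 - ρ ^ 2) * (V + 2 * κ) ^ 3) := by gcongr
    _ = _ := by ring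

theorem eventually_le_mul_sin_pi_div {ε : ℝ} (hε : 0 < ε) :
    ∃ M₁ : ℝ, 0 < M₁ ∧ ∀ M, M₁ ≤ M →
      Real.pi ^ 2 * (1 - ε) ≤ M ^ 2 * Real.sin (Real.pi / M) ^ 2 := by
  have h1 : Tendsto (fun M : ℝ => (Real.pi * Real.sinc (Real.pi / M)) ^ 2) atTop
      (𝓝 ((Real.pi * Real.sinc 0) ^ 2)) := by
    refine ((Real.continuous_sinc.continuousAt.tendsto.comp ?_).const_mul _).pow 2
    exact tendsto_const_nhds.div_atTop tendsto_id
  rw [Real.sinc_zero, mul_one] at h1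
  have h2 : Real.pi ^ 2 * (1 - ε) < Real.pi ^ 2 := by
    have := Real.pi_pos
    nlinarith [pow_pos this 2]
  obtain ⟨M₀, hM₀⟩ := eventually_atTop.mp (h1.eventually (lt_mem_nhds h2))
  refine ⟨max M₀ 1, by positivity, fun M hM => ?_⟩
  have hM0 : M₀ ≤ M := le_trans (le_max_left _ _) hM
  have hM1 : 1 ≤ M := le_trans (le_max_right _ _) hM
  refine (hM₀ M hM0).le.trans (le_of_eq ?_)
  have hpi := Real.pi_pos
  rw [Real.sinc_of_ne_zero (by positivity)]
  field_simp

/-- With `x = n ^ (1/3)`, `y = M / x` and `V = n s / M`, the energy over `x` is `y (V + μ)`, while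
`y ^ 3 V = M ^ 2 s` is nearly at least `π ^ 2` for large `M`. The arithmetic-geometric mean
inequality gives the minimum, attained only near `V = μ / 2`. -/
theorem exists_energy_gap {μ δ : ℝ} (hμ : 0 < μ) (hδ : 0 < δ) :
    ∃ η > 0, ∀ᶠ n : ℕ in atTop, ∀ i : SpectralIndex,
      (δ ≤ |n * i.sq / i.len - μ / 2| ∨ δ ≤ i.sq ∨ δ ≤ 1 / i.len) →
      (minEnergy μ + η) * (n : ℝ) ^ (1 / 3 : ℝ) ≤ i.energy μ n := by
  set ρ := δ / (3 * (μ / 2) + δ) with hρ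
  have hρ0 : 0 < ρ := by positivity
  have hρ1 : ρ < 1 := by rw [hρ, div_lt_one (by positivity)]; linarith
  have hρ2 : 0 < 1 - ρ ^ 2 := by nlinarith
  obtain ⟨M₁, hM₁, hsin⟩ := eventually_le_mul_sin_pi_div (ε := ρ ^ 2 / 2) (by positivity)
  have hc := minEnergy_pos hμ
  have hc3 : minEnergy μ ^ 3 = 27 * (μ / 2) ^ 2 * Real.pi ^ 2 := by
    rw [minEnergy, mul_pow, saddle_pow hμ]; field_simp; norm_num
  obtain ⟨η, hη, hη3⟩ : ∃ η > 0, (minEnergy μ + η) ^ 3 < minEnergy μ ^ 3 * (1 + ρ ^ 2 / 2) := by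
    have hcont : Tendsto (fun η : ℝ => (minEnergy μ + η) ^ 3) (𝓝[>] 0) (𝓝 ((minEnergy μ + 0) ^ 3)) :=
      ((continuous_const.add continuous_id).pow 3).continuousAt.tendsto.mono_left
        nhdsWithin_le_nhds
    have hlt : (minEnergy μ + 0) ^ 3 < minEnergy μ ^ 3 * (1 + ρ ^ 2 / 2) := by
      rw [add_zero]
      have := pow_pos hc 3
      nlinarith [pow_pos hρ0 2]
    obtain ⟨η, h1, h2⟩ := ((hcont.eventually (gt_mem_nhds hlt)).and self_mem_nhdsWithin).exists
    exact ⟨η, h2, h1⟩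
  refine ⟨η, hη, ?_⟩
  -- The three entries bound `s` below when `1 / M ≥ δ`, when `s ≥ δ`, and when `M < M₁`. In each
  -- case the energy is at least `n B = x ^ 3 B`, far above order `x`.
  set B := min (4 * δ ^ 2) (min δ (4 / M₁ ^ 2)) with hB
  have hB0 : 0 < B := by positivity
  filter_upwards [tendsto_cbrt.eventually_ge_atTop (max 1 ((minEnergy μ + η) / B))] with n hn i hi
  set x := (n : ℝ) ^ (1 / 3 : ℝ) with hx
  have hx1 : 1 ≤ x := le_trans (le_max_left _ _) hn
  have hx2 : minEnergy μ + η ≤ x * B := (div_le_iff₀ hB0).mp (le_trans (le_max_right _ _) hn)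
  have hx3 : x ^ 3 = n := rpow_third_pow (Nat.cast_nonneg n)
  have hM := i.len_pos
  have hs := i.sq_nonneg
  have hlarge : B ≤ i.sq → (minEnergy μ + η) * x ≤ i.energy μ n := by
    intro hBs
    have h1 : x ^ 2 * x * B ≤ n * i.sq := by
      rw [← hx3]
      calc x ^ 2 * x * B = x ^ 3 * B := by ring
        _ ≤ _ := by gcongr
    have h2 : (minEnergy μ + η) * x ≤ x ^ 2 * x * B := by
      calc _ ≤ (x * B) * x := by gcongr
        _ ≤ (x * B) * (x * x) := by gcongr; nlinarith
        _ = _ := by ring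
    rw [SpectralIndex.energy]
    nlinarith [mul_pos hμ hM]
  by_cases hbig : M₁ ≤ i.len
  swap
  · refine hlarge (le_trans (le_trans (min_le_right _ _) (min_le_right _ _)) ?_)
    refine le_trans ?_ (four_div_le_sq i)
    have := (not_le.mp hbig).le
    gcongr
  rcases hi with hi | hi | hi
  · have hV : 0 ≤ n * i.sq / i.len := by positivity
    have hP : Real.pi ^ 2 * (1 - ρ ^ 2 / 2) ≤ (i.len / x) ^ 3 * (n * i.sq / i.len) := by
      refine (hsin i.len hbig).trans ?_
      rw [← hx3]
      have : (i.len / x) ^ 3 * (x ^ 3 * i.sq / i.len) = i.len ^ 2 * i.sq := by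
        field_simp
      rw [this]
      gcongr
      exact sin_pi_div_sq_le_sq i
    have h1 := amgm_gap (κ := μ / 2) (by positivity) hδ hV (by positivity) hP hi
    rw [← hρ] at h1
    have h2 : i.len / x * (n * i.sq / i.len + 2 * (μ / 2)) = i.energy μ n / x := by
      rw [SpectralIndex.energy]; field_simp; ring
    rw [h2] at h1
    have h3 : (minEnergy μ + η) ^ 3 < (i.energy μ n / x) ^ 3 := by
      refine hη3.trans_le ?_
      have h4 : minEnergy μ ^ 3 * (1 - ρ ^ 2 / 2) ≤ (1 - ρ ^ 2) * (i.energy μ n / x) ^ 3 := by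
        rw [hc3]; linarith
      -- The gain `ρ ^ 2` is split: half pays for replacing the sine by its argument, and the rest
      -- leaves the gap `η`.
      have h5 : (1 - ρ ^ 2) * (minEnergy μ ^ 3 * (1 + ρ ^ 2 / 2)) ≤
          minEnergy μ ^ 3 * (1 - ρ ^ 2 / 2) := by
        have := pow_pos hc 3
        nlinarith [pow_pos hρ0 4]
      exact le_of_mul_le_mul_left (h5.trans h4) hρ2
    have h6 : minEnergy μ + η ≤ i.energy μ n / x := by
      refine le_of_lt (lt_of_pow_lt_pow_left₀ 3 ?_ h3)
      have := mul_pos hμ hM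
      rw [SpectralIndex.energy]; positivity
    rwa [le_div_iff₀ (by positivity)] at h6
  · exact hlarge (le_trans (le_trans (min_le_right _ _) (min_le_left _ _)) hi)
  · refine hlarge (le_trans (min_le_left _ _) (le_trans ?_ (four_div_le_sq i)))
    calc 4 * δ ^ 2 ≤ 4 * (1 / i.len) ^ 2 := by gcongr
      _ = _ := by ring

theorem summable_exp_neg_mul_len {τ : ℝ} (hτ : 0 < τ) :
    Summable fun i : SpectralIndex => Real.exp (-(τ * i.len)) := by
  rw [summable_sigma_of_nonneg fun i => (Real.exp_pos _).le]
  refine ⟨fun h => (hasSum_fintype _).summable, ?_⟩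
  simp only [SpectralIndex.len, tsum_fintype, Finset.sum_const, Finset.card_univ,
    Fintype.card_fin, nsmul_eq_mul]
  have h1 : Summable fun h : ℕ => ((h : ℝ) ^ 1 * Real.exp (-τ * h)) :=
    Real.summable_pow_mul_exp_neg_nat_mul 1 hτ
  have h2 := ((summable_nat_add_iff 1).mpr h1).mul_left (Real.exp (-τ))
  refine h2.congr fun h => ?_
  rw [pow_one, mul_left_comm, ← Real.exp_add]
  push_cast
  ring_nf

theorem SpectralIndex.mul_len_le_energy (μ : ℝ) (n : ℕ) (i : SpectralIndex) :
    μ * i.len ≤ i.energy μ n := by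
  have := i.sq_nonneg
  rw [SpectralIndex.energy]
  have : 0 ≤ n * i.sq := by positivity
  linarith

theorem summable_spectralWeight {μ : ℝ} (hμ : 0 < μ) (n : ℕ) :
    Summable (spectralWeight μ n) := by
  refine Summable.of_nonneg_of_le (spectralWeight_nonneg μ n) (fun i => ?_)
    ((summable_exp_neg_mul_len hμ).mul_left (Real.exp (2 * μ)))
  refine (spectralWeight_le μ n i).trans ?_
  have := i.mul_len_le_energy μ n
  gcongr

/-- The weight of the indices of energy well above the minimum is exponentially small. -/
theorem exists_spectralWeight_le_of_energy {μ η : ℝ} (hμ : 0 < μ) (hη : 0 < η) :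
    ∃ b : SpectralIndex → ℝ, Summable b ∧ (∀ i, 0 ≤ b i) ∧ ∀ (n : ℕ) (i : SpectralIndex),
      (minEnergy μ + η) * (n : ℝ) ^ (1 / 3 : ℝ) ≤ i.energy μ n →
      spectralWeight μ n i ≤ b i * Real.exp (-((minEnergy μ + η / 2) * (n : ℝ) ^ (1 / 3 : ℝ))) := by
  have hc := minEnergy_pos hμ
  -- A fraction `τ` of the energy is kept to make the bound summable over indices, as the energy
  -- dominates `μ * len`; the remaining fraction still yields `minEnergy μ + η / 2`.
  set τ := η / 2 / (minEnergy μ + η) with hτ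
  have hτ0 : 0 < τ := by positivity
  have hτ1 : (1 - τ) * (minEnergy μ + η) = minEnergy μ + η / 2 := by
    rw [hτ]; field_simp; ring
  have hτ2 : τ ≤ 1 := by
    rw [hτ, div_le_one (by positivity)]; linarith
  refine ⟨fun i => Real.exp (2 * μ) * Real.exp (-(τ * μ * i.len)),
    (summable_exp_neg_mul_len (mul_pos hτ0 hμ)).mul_left _, fun i => by positivity,
    fun n i hi => ?_⟩
  refine (spectralWeight_le μ n i).trans ?_
  rw [mul_assoc, ← Real.exp_add (-(τ * μ * i.len))]
  refine mul_le_mul_of_nonneg_left (Real.exp_le_exp.mpr ?_) (Real.exp_pos _).le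
  have h1 := i.mul_len_le_energy μ n
  have h2 : τ * (μ * i.len) ≤ τ * i.energy μ n := by gcongr
  have h3 : (1 - τ) * ((minEnergy μ + η) * (n : ℝ) ^ (1 / 3 : ℝ)) ≤ (1 - τ) * i.energy μ n :=
    mul_le_mul_of_nonneg_left hi (by linarith)
  rw [← mul_assoc, hτ1] at h3
  nlinarith

/-- For the lowest angle `s ≤ u = π² / M²`, and `log (1 - u) ≥ -u / (1 - u)` gives the term in `n`.
The prefactor `s / M ≥ 4 / M ^ 3` gives the logarithm. -/
theorem spectralWeight_lowest_ge {μ : ℝ} (n h : ℕ) (hM : Real.pi < (h : ℝ) + 2) (hμ : 0 < μ) :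
    Real.exp (-(μ * ((h : ℝ) + 2) + 3 * Real.log ((h : ℝ) + 2) +
      n * (Real.pi ^ 2 / (((h : ℝ) + 2) ^ 2 - Real.pi ^ 2)))) ≤ spectralWeight μ n ⟨h, 0⟩ := by
  set i : SpectralIndex := ⟨h, 0⟩ with hi
  have hlen : i.len = (h : ℝ) + 2 := rfl
  rw [← hlen] at hM ⊢
  have hpi := Real.pi_pos
  have hM2 := i.two_le_len
  have hs4 := four_div_le_sq i
  have hsle : i.sq ≤ Real.pi ^ 2 / i.len ^ 2 := by
    have : i.sq = Real.sin (Real.pi / i.len) ^ 2 := by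
      have h0 : ((i.2 : ℕ) : ℝ) = 0 := by change ((0 : ℕ) : ℝ) = 0; simp
      rw [SpectralIndex.sq, sinSq, angle, SpectralIndex.len, h0, zero_add, mul_one]
    rw [this, ← div_pow]
    exact pow_le_pow_left₀ (Real.sin_nonneg_of_nonneg_of_le_pi (by positivity)
      (div_le_self hpi.le (by linarith))) (Real.sin_le (by positivity)) 2
  have hlt : Real.pi ^ 2 < i.len ^ 2 := pow_lt_pow_left₀ hM hpi.le (by norm_num)
  have h1 : 0 < i.len ^ 2 - Real.pi ^ 2 := by linarith
  have h2 : 1 - Real.pi ^ 2 / i.len ^ 2 = (i.len ^ 2 - Real.pi ^ 2) / i.len ^ 2 := by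
    field_simp
  have hc : 0 < 1 - Real.pi ^ 2 / i.len ^ 2 := by rw [h2]; positivity
  have hexp : Real.exp (-(Real.pi ^ 2 / (i.len ^ 2 - Real.pi ^ 2))) ≤ 1 - i.sq := by
    refine le_trans ?_ (show 1 - Real.pi ^ 2 / i.len ^ 2 ≤ 1 - i.sq by linarith)
    rw [← Real.le_log_iff_exp_le hc]
    refine le_trans (le_of_eq ?_) (Real.one_sub_inv_le_log_of_pos hc)
    rw [h2]
    field_simp
    ring
  have hpow : Real.exp (-(n * (Real.pi ^ 2 / (i.len ^ 2 - Real.pi ^ 2)))) ≤ (1 - i.sq) ^ n := by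
    calc _ = Real.exp (-(Real.pi ^ 2 / (i.len ^ 2 - Real.pi ^ 2))) ^ n := by
          rw [← Real.exp_nat_mul]; ring_nf
      _ ≤ _ := pow_le_pow_left₀ (Real.exp_pos _).le hexp n
  have hlog : Real.exp (-(3 * Real.log i.len)) ≤ 1 / i.len * i.sq := by
    have : Real.exp (-(3 * Real.log i.len)) = 1 / i.len ^ 3 := by
      rw [Real.exp_neg, mul_comm, Real.exp_mul, Real.exp_log (by linarith)]
      norm_num
    rw [this]
    calc 1 / i.len ^ 3 ≤ 1 / i.len * (4 / i.len ^ 2) := by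
          rw [div_mul_div_comm, ← pow_succ']
          gcongr; norm_num
      _ ≤ _ := by gcongr
  have hfirst : Real.exp (-(μ * i.len)) ≤ Real.exp (-μ * i.1) := by
    rw [SpectralIndex.len]
    gcongr
    nlinarith
  have hs := i.sq_nonneg
  calc _ = Real.exp (-(μ * i.len)) * Real.exp (-(3 * Real.log i.len)) *
        Real.exp (-(n * (Real.pi ^ 2 / (i.len ^ 2 - Real.pi ^ 2)))) := by
          rw [← Real.exp_add, ← Real.exp_add]; ring_nf
    _ ≤ Real.exp (-μ * i.1) * (1 / i.len * i.sq) * (1 - i.sq) ^ n := by gcongr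
    _ = _ := by rw [spectralWeight]; ring

/-- One term suffices: the lowest angle on the segment with `M = ⌈saddle μ * n ^ (1/3)⌉`, whose
exponent divided by `n ^ (1/3)` tends to `minEnergy μ`. -/
theorem eventually_exp_le_tsum_spectralWeight {μ η : ℝ} (hμ : 0 < μ) (hη : 0 < η) :
    ∀ᶠ n : ℕ in atTop, Real.exp (-((minEnergy μ + η) * (n : ℝ) ^ (1 / 3 : ℝ))) ≤
      ∑' i, spectralWeight μ n i := by
  have ht := saddle_pos hμ
  have hpi := Real.pi_pos
  set x : ℕ → ℝ := fun n => (n : ℝ) ^ (1 / 3 : ℝ) with hx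
  set m : ℕ → ℝ := fun n => ((⌈saddle μ * x n⌉₊ : ℕ) : ℝ) with hm
  have hxt : Tendsto x atTop atTop := tendsto_cbrt
  have hmx : Tendsto (fun n => m n / x n) atTop (𝓝 (saddle μ)) :=
    (tendsto_nat_ceil_mul_div_atTop ht.le).comp hxt
  have hmt : Tendsto m atTop atTop :=
    tendsto_natCast_atTop_atTop.comp (tendsto_nat_ceil_atTop.comp (hxt.const_mul_atTop ht))
  have hx0 : ∀ᶠ n in atTop, 0 < x n := hxt.eventually_gt_atTop 0
  have hlog : Tendsto (fun n => 3 * Real.log (m n) / x n) atTop (𝓝 0) := by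
    have h1 : Tendsto (fun y : ℝ => Real.log y / y) atTop (𝓝 0) := by
      simpa using Real.isLittleO_log_id_atTop.tendsto_div_nhds_zero
    have h2 := ((h1.comp hmt).mul hmx).const_mul 3
    rw [zero_mul, mul_zero] at h2
    refine h2.congr' ?_
    filter_upwards [hx0, hmt.eventually_gt_atTop 0] with n h3 h4
    simp only [Function.comp]
    field_simp
  have hlast : Tendsto (fun n : ℕ => (n : ℝ) * (Real.pi ^ 2 / (m n ^ 2 - Real.pi ^ 2)) / x n) atTop
      (𝓝 (Real.pi ^ 2 / (saddle μ ^ 2 - 0))) := by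
    have h1 : Tendsto (fun n => Real.pi ^ 2 / x n ^ 2) atTop (𝓝 0) :=
      tendsto_const_nhds.div_atTop ((tendsto_pow_atTop (by norm_num)).comp hxt)
    have h2 : Tendsto (fun n => Real.pi ^ 2 / ((m n / x n) ^ 2 - Real.pi ^ 2 / x n ^ 2)) atTop
      (𝓝 (Real.pi ^ 2 / (saddle μ ^ 2 - 0))) :=
      tendsto_const_nhds.div ((hmx.pow 2).sub h1) (by rw [sub_zero]; positivity)
    refine h2.congr' ?_
    filter_upwards [hx0, hmt.eventually_gt_atTop Real.pi] with n h3 h4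
    have h5 : x n ^ 3 = n := rpow_third_pow (Nat.cast_nonneg n)
    have h6 : m n ^ 2 - Real.pi ^ 2 ≠ 0 := by nlinarith
    rw [← h5]
    field_simp
  have hsum := ((hmx.const_mul μ).add hlog).add hlast
  -- Here `saddle μ` is the minimiser `t` of `μ t + π² / t²`, where `π² = t ^ 3 μ / 2`.
  have hval : μ * saddle μ + 0 + Real.pi ^ 2 / (saddle μ ^ 2 - 0) = minEnergy μ := by
    have h1 : Real.pi ^ 2 = saddle μ ^ 3 * (μ / 2) := by
      rw [saddle_pow hμ]; field_simp
    rw [minEnergy, h1]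
    field_simp
    ring
  rw [hval] at hsum
  have hev := hsum.eventually (gt_mem_nhds (show minEnergy μ < minEnergy μ + η by linarith))
  filter_upwards [hev, hx0, hmt.eventually_gt_atTop 4] with n h1 h2 h3
  obtain ⟨h, hh⟩ : ∃ h, ⌈saddle μ * x n⌉₊ = h + 2 := by
    have : (4 : ℝ) < ((⌈saddle μ * x n⌉₊ : ℕ) : ℝ) := h3
    have : 4 < ⌈saddle μ * x n⌉₊ := by exact_mod_cast this
    exact ⟨⌈saddle μ * x n⌉₊ - 2, by omega⟩
  have hmh : m n = (h : ℝ) + 2 := by simp only [hm]; rw [hh]; push_cast; ring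
  have h4 := spectralWeight_lowest_ge (μ := μ) n h (by rw [← hmh]; linarith [Real.pi_le_four]) hμ
  refine le_trans ?_ (h4.trans ((summable_spectralWeight hμ n).le_tsum _
    fun i _ => spectralWeight_nonneg μ n i))
  rw [← hmh]
  gcongr
  rw [mul_comm]
  have h5 : (μ * m n + 3 * Real.log (m n) + n * (Real.pi ^ 2 / (m n ^ 2 - Real.pi ^ 2))) / x n <
      minEnergy μ + η := by
    refine lt_of_eq_of_lt ?_ h1
    ring
  rw [div_lt_iff₀ h2] at h5
  linarith

theorem tendsto_pow_mul_exp_neg_cbrt (p : ℕ) {a : ℝ} (ha : 0 < a) (C : ℝ) :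
    Tendsto (fun n : ℕ => C * ((n : ℝ) + 1) ^ p * Real.exp (-(a * (n : ℝ) ^ (1 / 3 : ℝ)))) atTop
      (𝓝 0) := by
  have h1 : Tendsto (fun y : ℝ => y ^ (3 * p) * Real.exp (-a * y)) atTop (𝓝 0) := by
    have := tendsto_rpow_mul_exp_neg_mul_atTop_nhds_zero ((3 * p : ℕ) : ℝ) a ha
    simpa only [Real.rpow_natCast] using this
  have h2 := (h1.comp tendsto_cbrt).const_mul (|C| * 2 ^ p)
  rw [mul_zero] at h2
  refine squeeze_zero_norm' ?_ h2
  filter_upwards [eventually_ge_atTop 1] with n hn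
  have hn1 : (1 : ℝ) ≤ n := by exact_mod_cast hn
  rw [norm_mul, norm_mul, Real.norm_eq_abs, Real.norm_eq_abs, Real.norm_eq_abs, Real.abs_exp,
    abs_of_nonneg (a := ((n : ℝ) + 1) ^ p) (by positivity)]
  simp only [Function.comp]
  rw [pow_mul, rpow_third_pow (Nat.cast_nonneg n)]
  calc |C| * ((n : ℝ) + 1) ^ p * Real.exp (-(a * (n : ℝ) ^ (1 / 3 : ℝ)))
      ≤ |C| * (2 * n) ^ p * Real.exp (-(a * (n : ℝ) ^ (1 / 3 : ℝ))) := by gcongr; linarith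
    _ = _ := by rw [mul_pow]; ring_nf

/-- Laplace's method for the spectral sums. -/
theorem tendsto_spectralSum_div {μ : ℝ} (hμ : 0 < μ) (φ : ℕ → SpectralIndex → ℝ) (l C : ℝ) (p : ℕ)
    (hbound : ∀ n i, |φ n i| ≤ C * ((n : ℝ) + 1) ^ p)
    (hlim : ∀ ε > 0, ∃ δ > 0, ∀ᶠ n : ℕ in atTop, ∀ i : SpectralIndex,
      |n * i.sq / i.len - μ / 2| < δ → i.sq < δ → 1 / i.len < δ → |φ n i - l| ≤ ε) :
    Tendsto (fun n => (∑' i, spectralWeight μ n i * φ n i) / ∑' i, spectralWeight μ n i) atTop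
      (𝓝 l) := by
  rw [Metric.tendsto_atTop']
  intro ε hε
  obtain ⟨δ, hδ, hgood⟩ := hlim (ε / 2) (by positivity)
  obtain ⟨η, hη, hgap⟩ := exists_energy_gap hμ hδ
  obtain ⟨b, hb, hb0, hbad⟩ := exists_spectralWeight_le_of_energy hμ hη
  have hsmall := tendsto_pow_mul_exp_neg_cbrt p (show 0 < η / 4 by positivity)
    ((C + |l|) * ∑' i, b i)
  have hev := hsmall.eventually (gt_mem_nhds (show (0 : ℝ) < ε / 2 by positivity))
  have hlow := eventually_exp_le_tsum_spectralWeight hμ (show 0 < η / 4 by positivity)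
  obtain ⟨N, hN⟩ := eventually_atTop.mp (hgood.and (hgap.and (hev.and hlow)))
  refine ⟨N, fun n hn => ?_⟩
  obtain ⟨hgood, hgap, hev, hlow⟩ := hN n hn.le
  set x := (n : ℝ) ^ (1 / 3 : ℝ) with hx
  set Z := ∑' i, spectralWeight μ n i with hZ
  have hw := summable_spectralWeight hμ n
  have hZ0 : 0 < Z := (Real.exp_pos _).trans_le hlow
  have hC0 : 0 ≤ C := by
    have := (abs_nonneg _).trans (hbound 0 ⟨0, 0⟩)
    simpa using this
  set K := (C + |l|) * ((n : ℝ) + 1) ^ p * Real.exp (-((minEnergy μ + η / 2) * x)) with hK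
  have hp1 : (1 : ℝ) ≤ ((n : ℝ) + 1) ^ p := one_le_pow₀ (by linarith [Nat.cast_nonneg (α := ℝ) n])
  have hdiff : ∀ i, |φ n i - l| ≤ (C + |l|) * ((n : ℝ) + 1) ^ p := by
    intro i
    calc |φ n i - l| ≤ |φ n i| + |l| := abs_sub _ _
      _ ≤ C * ((n : ℝ) + 1) ^ p + |l| * ((n : ℝ) + 1) ^ p :=
        add_le_add (hbound n i) (le_mul_of_one_le_right (abs_nonneg _) hp1)
      _ = _ := by ring
  have hterm : ∀ i, |spectralWeight μ n i * (φ n i - l)| ≤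
      ε / 2 * spectralWeight μ n i + K * b i := by
    intro i
    have hwi := spectralWeight_nonneg μ n i
    have hK0 : 0 ≤ K := by positivity
    rw [abs_mul, abs_of_nonneg hwi]
    by_cases hi : δ ≤ |n * i.sq / i.len - μ / 2| ∨ δ ≤ i.sq ∨ δ ≤ 1 / i.len
    · have h1 := hbad n i (hgap i hi)
      have h2 : spectralWeight μ n i * |φ n i - l| ≤ K * b i := by
        calc _ ≤ (b i * Real.exp (-((minEnergy μ + η / 2) * x))) *
              ((C + |l|) * ((n : ℝ) + 1) ^ p) :=
              mul_le_mul h1 (hdiff i) (abs_nonneg _) (mul_nonneg (hb0 i) (Real.exp_pos _).le)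
          _ = _ := by rw [hK]; ring
      have : 0 ≤ ε / 2 * spectralWeight μ n i := by positivity
      linarith
    · simp only [not_or, not_le] at hi
      have h1 := hgood i hi.1 hi.2.1 hi.2.2
      have h2 : 0 ≤ K * b i := mul_nonneg hK0 (hb0 i)
      have h3 := mul_le_mul_of_nonneg_left h1 hwi
      linarith
  have hsb : Summable fun i => ε / 2 * spectralWeight μ n i + K * b i :=
    (hw.mul_left _).add (hb.mul_left _)
  have hsd : Summable fun i => spectralWeight μ n i * (φ n i - l) :=
    Summable.of_norm_bounded hsb hterm
  have hsum : ∑' i, spectralWeight μ n i * φ n i =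
      ∑' i, spectralWeight μ n i * (φ n i - l) + l * Z := by
    rw [hZ, ← tsum_mul_left, ← hsd.tsum_add (hw.mul_left _)]
    exact tsum_congr fun i => by ring
  have habs : |∑' i, spectralWeight μ n i * (φ n i - l)| ≤ ε / 2 * Z + K * ∑' i, b i := by
    rw [hZ, ← tsum_mul_left, ← tsum_mul_left,
      ← (hw.mul_left _).tsum_add (hb.mul_left _)]
    rw [← Real.norm_eq_abs]
    exact tsum_of_norm_bounded hsb.hasSum fun i => by rw [Real.norm_eq_abs]; exact hterm i
  rw [Real.dist_eq, hsum, add_div, mul_div_cancel_right₀ _ hZ0.ne', add_sub_cancel_right, abs_div,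
    abs_of_pos hZ0, div_lt_iff₀ hZ0]
  refine habs.trans_lt ?_
  -- The bad indices decay with exponent `minEnergy μ + η / 2`, whereas `Z` has the lower bound with
  -- `η / 4`; the difference beats the polynomial factor.
  have hKb : K * ∑' i, b i < ε / 2 * Z := by
    have h1 : K * ∑' i, b i = ((C + |l|) * (∑' i, b i) * ((n : ℝ) + 1) ^ p *
        Real.exp (-(η / 4 * x))) * Real.exp (-((minEnergy μ + η / 4) * x)) := by
      rw [hK, mul_assoc _ (Real.exp (-(η / 4 * x))), ← Real.exp_add]
      ring_nf
    rw [h1]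
    calc _ < ε / 2 * Real.exp (-((minEnergy μ + η / 4) * x)) := by gcongr
      _ ≤ _ := by gcongr
  linarith

theorem exists_abs_eval_le (R : MvPolynomial (Fin 3) ℝ) :
    ∃ (C : ℝ) (p : ℕ), 0 ≤ C ∧ ∀ B : ℝ, 1 ≤ B → ∀ y : Fin 3 → ℝ, (∀ i, |y i| ≤ B) →
      |MvPolynomial.eval y R| ≤ C * B ^ p := by
  induction R using MvPolynomial.induction_on with
  | C a => exact ⟨|a|, 0, abs_nonneg _, fun B _ y _ => by simp⟩
  | add f g hf hg =>
    obtain ⟨C, p, hC, hp⟩ := hf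
    obtain ⟨D, q, hD, hq⟩ := hg
    refine ⟨C + D, p + q, by positivity, fun B hB y hy => ?_⟩
    rw [map_add]
    have h1 : B ^ p ≤ B ^ (p + q) := pow_le_pow_right₀ hB (by omega)
    have h2 : B ^ q ≤ B ^ (p + q) := pow_le_pow_right₀ hB (by omega)
    calc _ ≤ |MvPolynomial.eval y f| + |MvPolynomial.eval y g| := abs_add_le _ _
      _ ≤ C * B ^ p + D * B ^ q := add_le_add (hp B hB y hy) (hq B hB y hy)
      _ ≤ C * B ^ (p + q) + D * B ^ (p + q) := by gcongr
      _ = _ := by ring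
  | mul_X f i hf =>
    obtain ⟨C, p, hC, hp⟩ := hf
    refine ⟨C, p + 1, hC, fun B hB y hy => ?_⟩
    rw [map_mul, MvPolynomial.eval_X, abs_mul, pow_succ, ← mul_assoc]
    exact mul_le_mul (hp B hB y hy) (hy i) (abs_nonneg _) (by positivity)

/-- The generating coefficients of forests of `k` trees, weighted by height. -/
noncomputable def heightSum (μ : ℝ) (k n : ℕ) : ℝ :=
  ∑' h : ℕ, Real.exp (-μ * h) * PowerSeries.coeff n (heightSeries h ^ k)

/-- The limiting weight of a level with `k` vertices. -/
noncomputable def limitWeight (μ : ℝ) (k : ℕ) : ℝ :=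
  2 ^ k * (∑ i ∈ Finset.range k, (k.choose (i + 1) : ℝ) * μ ^ i / (i.factorial : ℝ)) / 2

/-- The index shift `a` goes into a factor `(1 - s) ^ a`, which tends to `1` where the weights
concentrate. All values of `k` and `a` then share the normaliser `∑' i, spectralWeight μ n i`, which
drops out of ratios. -/
theorem heightSum_eq_and_tendsto {μ : ℝ} (hμ : 0 < μ) (k a : ℕ) (hk : 1 ≤ k) :
    (∀ n, Summable fun h : ℕ =>
      Real.exp (-μ * h) * PowerSeries.coeff n (heightSeries h ^ k)) ∧
    Tendsto (fun n => heightSum μ k (n + a) / ∑' i, spectralWeight μ n i) atTop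
      (𝓝 (limitWeight μ k * 2)) := by
  obtain ⟨R, hR, hR0⟩ := exists_coeff_heightSeries_pow k hk
  obtain ⟨C, p, hC, hCp⟩ := exists_abs_eval_le R
  set φ : ℕ → ℕ → SpectralIndex → ℝ := fun a n i => (1 - i.sq) ^ a *
    MvPolynomial.eval ![((n : ℝ) + a + k) * i.sq * (1 / i.len), i.sq, 1 / i.len] R with hφ
  have hbound : ∀ a n i, |φ a n i| ≤ C * ((a : ℝ) + k + 1) ^ p * ((n : ℝ) + 1) ^ p := by
    intro a n i
    have hs0 := i.sq_nonneg
    have hs1 := i.sq_le_one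
    have hl := i.two_le_len
    have hv1 : 1 / i.len ≤ 1 := by rw [div_le_one (by linarith)]; linarith
    have hv0 : 0 ≤ 1 / i.len := by positivity
    have hn := Nat.cast_nonneg (α := ℝ) n
    have ha := Nat.cast_nonneg (α := ℝ) a
    have hk0 := Nat.cast_nonneg (α := ℝ) k
    have hB : (1 : ℝ) ≤ ((a : ℝ) + k + 1) * ((n : ℝ) + 1) := by nlinarith
    have h1 := hCp _ hB ![((n : ℝ) + a + k) * i.sq * (1 / i.len), i.sq, 1 / i.len] (by
      intro t
      fin_cases t
      · simp only [Fin.zero_eta, Matrix.cons_val_zero]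
        rw [abs_of_nonneg (by positivity)]
        calc ((n : ℝ) + a + k) * i.sq * (1 / i.len) ≤ ((n : ℝ) + a + k) * 1 * 1 := by gcongr
          _ ≤ _ := by nlinarith
      · simp only [Fin.mk_one, Matrix.cons_val_one, Matrix.cons_val_zero]
        rw [abs_of_nonneg hs0]; linarith
      · simp only [Fin.reduceFinMk, Matrix.cons_val]
        rw [abs_of_nonneg hv0]; linarith)
    rw [mul_pow, ← mul_assoc] at h1
    simp only [hφ]
    rw [abs_mul, abs_of_nonneg (pow_nonneg (by linarith) a)]
    have h2 : (1 - i.sq) ^ a ≤ 1 := pow_le_one₀ (by linarith) (by linarith)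
    exact (mul_le_of_le_one_left (abs_nonneg _) h2).trans h1
  have hsum : ∀ a n, Summable fun i => spectralWeight μ n i * φ a n i := by
    intro a n
    refine Summable.of_norm_bounded ((summable_spectralWeight hμ n).mul_right
      (C * ((a : ℝ) + k + 1) ^ p * ((n : ℝ) + 1) ^ p)) fun i => ?_
    rw [norm_mul, Real.norm_of_nonneg (spectralWeight_nonneg μ n i)]
    exact mul_le_mul_of_nonneg_left (hbound a n i) (spectralWeight_nonneg μ n i)
  have hterm : ∀ a n h : ℕ, Real.exp (-μ * h) * PowerSeries.coeff (n + a) (heightSeries h ^ k) =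
      ∑' j : Fin (h + 1), spectralWeight μ n ⟨h, j⟩ * φ a n ⟨h, j⟩ := by
    intro a n h
    rw [hR, tsum_fintype, Finset.mul_sum, Finset.mul_sum, ← Fin.sum_univ_eq_sum_range
      (fun j => Real.exp (-μ * h) * (1 / ((h : ℝ) + 2) * (sinSq h j * (1 - sinSq h j) ^ (n + a) *
        MvPolynomial.eval ![(((n + a : ℕ) : ℝ) + k) * sinSq h j * (1 / ((h : ℝ) + 2)), sinSq h j,
          1 / ((h : ℝ) + 2)] R)))]
    refine Finset.sum_congr rfl fun j _ => ?_
    simp only [spectralWeight, hφ, SpectralIndex.len, SpectralIndex.sq]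
    rw [pow_add]
    push_cast
    ring
  constructor
  · intro n
    have h1 := (hsum 0 n).sigma
    refine h1.congr fun h => ?_
    rw [← hterm 0 n h, add_zero]
  · have heq : ∀ n, heightSum μ k (n + a) = ∑' i, spectralWeight μ n i * φ a n i := by
      intro n
      rw [(hsum a n).tsum_sigma, heightSum]
      exact tsum_congr fun h => hterm a n h
    simp only [heq]
    refine tendsto_spectralSum_div hμ (φ a) _ _ p (hbound a) fun ε hε => ?_
    have hcont : ContinuousAt (fun y : ℝ × ℝ × ℝ => (1 - y.2.1) ^ a *
        MvPolynomial.eval ![y.1, y.2.1, y.2.2] R) (μ / 2, 0, 0) := by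
      refine Continuous.continuousAt ?_
      refine Continuous.mul (by fun_prop) ((MvPolynomial.continuous_eval R).comp ?_)
      refine continuous_pi fun t => ?_
      fin_cases t
      · exact continuous_fst
      · exact continuous_snd.fst
      · exact continuous_snd.snd
    obtain ⟨δ, hδ, hball⟩ := Metric.continuousAt_iff.mp hcont ε hε
    set D : ℝ := (a : ℝ) + k + 1 with hD
    have hD1 : 1 ≤ D := by rw [hD]; linarith [Nat.cast_nonneg (α := ℝ) a, Nat.cast_nonneg (α := ℝ) k]
    refine ⟨δ / (2 * D), by positivity, Eventually.of_forall fun n i h1 h2 h3 => ?_⟩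
    have hs0 := i.sq_nonneg
    have hl := i.two_le_len
    have hv1 : 1 / i.len ≤ 1 := by rw [div_le_one (by linarith)]; linarith
    have hv0 : 0 ≤ 1 / i.len := by positivity
    have hδD : δ / (2 * D) * D = δ / 2 := by field_simp
    have hδD' : δ / (2 * D) ≤ δ / 2 := by
      rw [← hδD]; exact le_mul_of_one_le_right (by positivity) hD1
    have h4 := hball (x := (((n : ℝ) + a + k) * i.sq * (1 / i.len), i.sq, 1 / i.len)) (by
      rw [Prod.dist_eq, Prod.dist_eq]
      refine max_lt ?_ (max_lt ?_ ?_)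
      · rw [Real.dist_eq]
        have e : ((n : ℝ) + a + k) * i.sq * (1 / i.len) - μ / 2 =
          (n * i.sq / i.len - μ / 2) + ((a : ℝ) + k) * (i.sq * (1 / i.len)) := by ring
        have h5 : i.sq * (1 / i.len) ≤ δ / (2 * D) * 1 := by gcongr
        have h6 : ((a : ℝ) + k) * (i.sq * (1 / i.len)) ≤ ((a : ℝ) + k) * (δ / (2 * D) * 1) := by
          gcongr
        have h7 : 0 ≤ ((a : ℝ) + k) * (i.sq * (1 / i.len)) := by positivity
        have h8 : ((a : ℝ) + k) * (δ / (2 * D) * 1) = δ / 2 - δ / (2 * D) := by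
          rw [← hδD, hD]; ring
        rw [e]
        refine (abs_add_le _ _).trans_lt ?_
        rw [abs_of_nonneg h7]
        linarith
      · simp only [Real.dist_eq, sub_zero]
        rw [abs_of_nonneg hs0]; linarith
      · simp only [Real.dist_eq, sub_zero]
        rw [abs_of_nonneg hv0]; linarith)
    simp only [sub_zero, one_pow, one_mul, hR0, Real.dist_eq, mul_div_cancel₀ μ (two_ne_zero)] at h4
    refine le_of_lt ?_
    rw [limitWeight, div_mul_cancel₀ _ (two_ne_zero)]
    exact h4

theorem limitWeight_one (μ : ℝ) : limitWeight μ 1 = 1 := by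
  simp [limitWeight]

theorem tendsto_heightSum_div {μ : ℝ} (hμ : 0 < μ) (k a b : ℕ) (hk : 1 ≤ k) :
    Tendsto (fun n => heightSum μ k (n + a) / heightSum μ 1 (n + b)) atTop
      (𝓝 (limitWeight μ k)) := by
  have h1 := (heightSum_eq_and_tendsto hμ k a hk).2
  have h2 := (heightSum_eq_and_tendsto hμ 1 b le_rfl).2
  rw [limitWeight_one] at h2
  have h3 := h1.div h2 (by norm_num)
  rw [one_mul, mul_div_cancel_right₀ _ (two_ne_zero)] at h3
  refine h3.congr' ?_
  filter_upwards [eventually_exp_le_tsum_spectralWeight hμ (one_pos)] with n hn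
  have : ∑' i, spectralWeight μ n i ≠ 0 := ((Real.exp_pos _).trans_le hn).ne'
  exact div_div_div_cancel_right₀ this _ _

/-! ### Counting trees with a prescribed ball, level by level. -/

theorem natCard_orderHom_fin (l k : ℕ) : Nat.card (Fin l →o Fin k) = k.multichoose l := by
  -- A monotone map is determined by the multiset of its values, recovered by sorting.
  let F : (Fin l →o Fin k) → Sym (Fin k) l :=
    fun f => ⟨(List.ofFn f : Multiset (Fin k)), by simp⟩
  have hF : Function.Bijective F := by
    constructor
    · intro f g h
      have h1 : (List.ofFn f).Perm (List.ofFn g) := Multiset.coe_eq_coe.mp (congrArg Subtype.val h)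
      have h2 := h1.eq_of_pairwise' f.monotone.sortedLE_ofFn.pairwise
        g.monotone.sortedLE_ofFn.pairwise
      exact OrderHom.ext _ _ (List.ofFn_injective h2)
    · intro s
      have hlen : (s.1.sort (· ≤ ·)).length = l := by rw [Multiset.length_sort]; exact s.2
      have hpw : (s.1.sort (· ≤ ·)).Pairwise (· ≤ ·) := Multiset.pairwise_sort _ _
      refine ⟨⟨fun i => (s.1.sort (· ≤ ·)).get (i.cast hlen.symm), fun i j hij => ?_⟩,
        Subtype.ext ?_⟩
      · rcases hij.eq_or_lt with rfl | hlt
        · exact le_rfl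
        · exact List.pairwise_iff_get.mp hpw _ _ hlt
      · change (↑(List.ofFn fun i : Fin l => (s.1.sort (· ≤ ·)).get (i.cast hlen.symm)) :
          Multiset (Fin k)) = s.1
        conv_rhs => rw [← Multiset.sort_eq s.1 (· ≤ ·)]
        congr 1
        refine List.ext_get (by simp) fun n h1 h2 => ?_
        simp only [List.get_ofFn]
        rfl
  rw [Nat.card_congr (Equiv.ofBijective F hF), Nat.card_eq_fintype_card,
    Sym.card_sym_fin_eq_multichoose]

instance finite_orderHom_fin (l k : ℕ) : Finite (Fin l →o Fin k) :=
  Finite.of_injective (fun f : Fin l →o Fin k => (f : Fin l → Fin k)) DFunLike.coe_injective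

theorem levelCard_eq_zero_of_le (T : PlanarTree) {r s : ℕ} (hrs : r ≤ s)
    (hr : T.levelCard r = 0) : T.levelCard s = 0 := by
  by_contra h
  have := T.levelCard_pos_of_le hrs (Nat.pos_of_ne_zero h)
  omega

theorem levelCard_ball (T : PlanarTree) {r s : ℕ} (hs : s ≤ r) :
    (T.ball r).levelCard s = T.levelCard s := by
  simp only [ball]
  rw [if_pos (by omega)]

theorem parent_ball (T : PlanarTree) {r s : ℕ} (hs : s < r) (i : ℕ) :
    (T.ball r).parent s i = T.parent s i := by
  simp only [ball]
  rw [if_pos (by omega)]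

theorem ball_eq_self_iff (T : PlanarTree) {r : ℕ} (hr : 1 ≤ r) :
    T.ball r = T ↔ T.levelCard (r + 1) = 0 := by
  have hm : max r 1 = r := max_eq_left hr
  constructor
  · intro h
    rw [← h]
    simp [ball, hm]
  · intro h
    ext s i
    · simp only [ball, hm]
      split_ifs with hs
      · rfl
      · exact (T.levelCard_eq_zero_of_le (by omega) h).symm
    · simp only [ball, hm]
      split_ifs with hs
      · rfl
      · refine (T.parent_outside s i ?_).symm
        rw [T.levelCard_eq_zero_of_le (show r + 1 ≤ s + 1 by omega) h]
        exact Nat.zero_le _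

theorem ball_one_eq (T T' : PlanarTree) : T.ball 1 = T'.ball 1 := by
  have key : ∀ S : PlanarTree, ∀ i, S.parent 0 i = 0 := by
    intro S i
    by_cases hb : i < S.levelCard (0 + 1)
    · have := S.parent_lt 0 i hb
      rw [S.levelCard_zero] at this
      omega
    · exact S.parent_outside 0 i (by omega)
  ext s i
  · simp only [ball, max_self]
    split_ifs with h
    · interval_cases s
      · rw [T.levelCard_zero, T'.levelCard_zero]
      · rw [T.levelCard_one, T'.levelCard_one]
    · rfl
  · simp only [ball, max_self]
    split_ifs with h
    · obtain rfl : s = 0 := by omega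
      rw [key, key]
    · rfl

/-- The tree obtained from the first `r` levels of `T` by adding a last level with parent map
`f`. -/
def extend (T : PlanarTree) (r : ℕ) (hr : 1 ≤ r) {l : ℕ} (f : Fin l →o Fin (T.levelCard r)) :
    PlanarTree where
  levelCard s := if s ≤ r then T.levelCard s else if s = r + 1 then l else 0
  parent s i := if s < r then T.parent s i else if h : s = r ∧ i < l then f ⟨i, h.2⟩ else 0
  levelCard_zero := by simp [T.levelCard_zero]
  levelCard_one := by rw [if_pos hr, T.levelCard_one]
  parent_lt s i h := by
    rcases lt_trichotomy s r with hs | rfl | hs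
    · rw [if_pos (by omega)] at h
      rw [if_pos hs, if_pos hs.le]
      exact T.parent_lt s i h
    · rw [if_neg (by omega), if_pos rfl] at h
      rw [if_neg (by omega), dif_pos ⟨rfl, h⟩, if_pos le_rfl]
      exact (f ⟨i, h⟩).2
    · rw [if_neg (by omega), if_neg (by omega)] at h
      omega
  parent_mono s i j hij h := by
    rcases lt_trichotomy s r with hs | rfl | hs
    · rw [if_pos (by omega)] at h
      rw [if_pos hs, if_pos hs]
      exact T.parent_mono s i j hij h
    · rw [if_neg (by omega), if_pos rfl] at h
      rw [if_neg (by omega), if_neg (by omega), dif_pos ⟨rfl, hij.trans_lt h⟩,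
        dif_pos ⟨rfl, h⟩]
      exact f.monotone (show (⟨i, hij.trans_lt h⟩ : Fin l) ≤ ⟨j, h⟩ from hij)
    · rw [if_neg (by omega), if_neg (by omega)] at h
      omega
  parent_outside s i h := by
    rcases lt_trichotomy s r with hs | rfl | hs
    · rw [if_pos (by omega)] at h
      rw [if_pos hs]
      exact T.parent_outside s i h
    · rw [if_neg (by omega), if_pos rfl] at h
      rw [if_neg (by omega), dif_neg (by omega)]
    · rw [if_neg (by omega), dif_neg (by omega)]

section Extend

variable (T : PlanarTree) (r : ℕ) (hr : 1 ≤ r)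

theorem levelCard_extend_of_le {l : ℕ} (f : Fin l →o Fin (T.levelCard r)) {s : ℕ} (hs : s ≤ r) :
    (T.extend r hr f).levelCard s = T.levelCard s := if_pos hs

theorem levelCard_extend {l : ℕ} (f : Fin l →o Fin (T.levelCard r)) :
    (T.extend r hr f).levelCard (r + 1) = l := by
  simp [extend]

theorem parent_extend {l : ℕ} (f : Fin l →o Fin (T.levelCard r)) (i : Fin l) :
    (T.extend r hr f).parent r i = f i := by
  simp [extend]

theorem ball_succ_extend {l : ℕ} (f : Fin l →o Fin (T.levelCard r)) :
    (T.extend r hr f).ball (r + 1) = T.extend r hr f := by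
  rw [ball_eq_self_iff _ (by omega)]
  simp [extend]

theorem ball_extend {l : ℕ} (f : Fin l →o Fin (T.levelCard r)) :
    (T.extend r hr f).ball r = T.ball r := by
  have hm : max r 1 = r := max_eq_left hr
  ext s i
  · simp only [ball, extend, hm]
    split_ifs <;> rfl
  · simp only [ball, extend, hm]
    split_ifs <;> rfl

theorem extend_injective :
    Function.Injective fun p : Σ l : ℕ, (Fin l →o Fin (T.levelCard r)) => T.extend r hr p.2 := by
  rintro ⟨l, f⟩ ⟨l', f'⟩ h
  have h1 : l = l' := by
    rw [← T.levelCard_extend r hr f, ← T.levelCard_extend r hr f']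
    exact congrFun (congrArg levelCard h) (r + 1)
  subst h1
  have h2 : f = f' := by
    refine OrderHom.ext _ _ (funext fun i => Fin.ext ?_)
    rw [← T.parent_extend r hr f, ← T.parent_extend r hr f']
    exact congrFun (congrFun (congrArg parent h) r) i
  rw [h2]

theorem exists_extend_eq {S : PlanarTree} (hS : S.ball r = T) :
    ∃ f : Fin (S.levelCard (r + 1)) →o Fin (T.levelCard r), T.extend r hr f = S.ball (r + 1) := by
  have hm : max (r + 1) 1 = r + 1 := by omega
  have hlev : ∀ s, s ≤ r → T.levelCard s = S.levelCard s := fun s hs => by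
    rw [← hS, levelCard_ball _ hs]
  have hpar : ∀ s i, s < r → T.parent s i = S.parent s i := fun s i hs => by
    rw [← hS, parent_ball _ hs]
  refine ⟨⟨fun i => ⟨S.parent r i, ?_⟩, fun i j hij => ?_⟩, ?_⟩
  · rw [hlev r le_rfl]
    exact S.parent_lt r i i.2
  · exact S.parent_mono r i j hij j.2
  · ext s i
    · simp only [extend, ball, hm]
      rcases lt_trichotomy s (r + 1) with hs | rfl | hs
      · rw [if_pos (by omega), if_pos (by omega), hlev s (by omega)]
      · rw [if_neg (by omega), if_pos rfl, if_pos le_rfl]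
      · rw [if_neg (by omega), if_neg (by omega), if_neg (by omega)]
    · simp only [extend, ball, hm]
      rcases lt_trichotomy s r with hs | rfl | hs
      · rw [if_pos hs, if_pos (by omega), hpar s i hs]
      · rw [if_neg (by omega), if_pos (by omega)]
        split_ifs with h
        · rfl
        · exact (S.parent_outside s i (by omega)).symm
      · rw [if_neg (by omega), dif_neg (by omega), if_neg (by omega)]

end Extend

/-- The number of forests with `k` roots, `n` edges and height at most `h`. -/
def forestCount : ℕ → ℕ → ℕ → ℕ
  | _, n, 0 => if n = 0 then 1 else 0
  | k, n, h + 1 => ∑ l : Fin (n + 1), k.multichoose l * forestCount l (n - l) h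

/-- The trees extending `T` above level `r` by at most `h` levels and `n` edges. -/
def extensions (T : PlanarTree) (r n h : ℕ) : Set PlanarTree :=
  {S | S.ball r = T ∧ S.levelCard (r + h + 1) = 0 ∧
    ∑ i ∈ Finset.range h, S.levelCard (r + i + 1) = n}

theorem extensions_zero (T : PlanarTree) {r : ℕ} (hr : 1 ≤ r) (hT : T.ball r = T) (n : ℕ) :
    T.extensions r n 0 = if n = 0 then {T} else ∅ := by
  ext S
  simp only [extensions, Set.mem_ofPred_eq, Finset.range_zero, Finset.sum_empty, add_zero]
  split_ifs with hn
  · subst hn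
    simp only [Set.mem_singleton_iff, and_true]
    rw [← S.ball_eq_self_iff hr]
    constructor
    · rintro ⟨h1, h2⟩
      rw [← h1, h2]
    · rintro rfl
      exact ⟨hT, hT⟩
  · simp only [Set.mem_empty_iff_false, iff_false]
    omega

/-- Decomposition of the extensions according to the first added level. -/
noncomputable def extensionsSuccEquiv (T : PlanarTree) {r : ℕ} (hr : 1 ≤ r) (hT : T.ball r = T)
    (n h : ℕ) :
    (Σ l : Fin (n + 1), Σ f : Fin l →o Fin (T.levelCard r),
      (T.extend r hr f).extensions (r + 1) (n - l) h) ≃ T.extensions r n (h + 1) :=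
  Equiv.ofBijective
    (fun p => ⟨p.2.2.1, by
      obtain ⟨l, f, S, h1, h2, h3⟩ := p
      refine ⟨?_, ?_, ?_⟩
      · rw [← S.ball_ball (show r ≤ r + 1 by omega), h1, ball_extend, hT]
      · change S.levelCard (r + (h + 1) + 1) = 0
        rwa [show r + (h + 1) + 1 = r + 1 + h + 1 by ring]
      · change ∑ i ∈ Finset.range (h + 1), S.levelCard (r + i + 1) = n
        have h4 : S.levelCard (r + 1) = l := by
          rw [← levelCard_ball S le_rfl, h1, levelCard_extend]
        rw [Finset.sum_range_succ', add_zero, h4]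
        have h5 : ∑ i ∈ Finset.range h, S.levelCard (r + (i + 1) + 1) = n - l := by
          rw [← h3]
          refine Finset.sum_congr rfl fun i _ => ?_
          congr 1
          ring
        have := l.2
        rw [h5]
        omega⟩)
    (by
      constructor
      · rintro ⟨l, f, S, h1⟩ ⟨l', f', S', h1'⟩ heq
        obtain rfl : S = S' := congrArg Subtype.val heq
        have h2 := T.extend_injective r hr (a₁ := ⟨l, f⟩) (a₂ := ⟨l', f'⟩)
          (h1.1.symm.trans h1'.1)
        rw [Sigma.mk.injEq] at h2
        obtain ⟨hl, hf⟩ := h2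
        obtain rfl := Fin.ext hl
        obtain rfl := eq_of_heq hf
        rfl
      · rintro ⟨S, h1, h2, h3⟩
        obtain ⟨f, hf⟩ := T.exists_extend_eq r hr h1
        rw [Finset.sum_range_succ', add_zero] at h3
        refine ⟨⟨⟨S.levelCard (r + 1), by omega⟩, f, S, hf.symm, ?_, ?_⟩, rfl⟩
        · rw [← h2]
          congr 1
          ring
        · simp only
          rw [← h3, Nat.add_sub_cancel]
          refine Finset.sum_congr rfl fun i _ => ?_
          congr 1
          ring)

theorem finite_and_natCard_extensions (T : PlanarTree) {r : ℕ} (hr : 1 ≤ r) (hT : T.ball r = T)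
    (n h : ℕ) : Finite (T.extensions r n h) ∧
      Nat.card (T.extensions r n h) = forestCount (T.levelCard r) n h := by
  induction h generalizing T r n with
  | zero =>
    rw [extensions_zero T hr hT, forestCount]
    split_ifs
    · exact ⟨inferInstance, by simp⟩
    · exact ⟨inferInstance, by simp⟩
  | succ h ih =>
    have hfin : ∀ (l : Fin (n + 1)) (f : Fin l →o Fin (T.levelCard r)),
        Finite ((T.extend r hr f).extensions (r + 1) (n - l) h) := fun l f =>
      (ih _ (by omega) (T.ball_succ_extend r hr f) _).1
    refine ⟨Finite.of_equiv _ (extensionsSuccEquiv T hr hT n h), ?_⟩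
    rw [← Nat.card_congr (extensionsSuccEquiv T hr hT n h), Nat.card_sigma, forestCount]
    refine Finset.sum_congr rfl fun l _ => ?_
    have := Fintype.ofFinite (Fin l →o Fin (T.levelCard r))
    rw [Nat.card_sigma, ← natCard_orderHom_fin, Nat.card_eq_fintype_card, ← smul_eq_mul,
      ← Finset.card_univ, ← Finset.sum_const]
    refine Finset.sum_congr rfl fun f _ => ?_
    rw [(ih _ (by omega) (T.ball_succ_extend r hr f) _).2, levelCard_extend]

section Count

open PowerSeries

/-- The negative binomial series for `(1 - X D)⁻¹ ^ k`, truncated at order `L`. The double induction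
follows Pascal's rule for `multichoose` and `E ^ (k + 1) = E ^ k + X D E ^ (k + 1)`. -/
theorem X_pow_dvd_inv_pow_sub {D E : PowerSeries ℝ} (hE : E * (1 - X * D) = 1) (k L : ℕ) :
    X ^ (L + 1) ∣ E ^ k - ∑ l ∈ Finset.range (L + 1), (k.multichoose l : PowerSeries ℝ) *
      (X * D) ^ l := by
  induction k generalizing L with
  | zero =>
    rw [Finset.sum_range_succ']
    simp
  | succ k ihk =>
    induction L with
    | zero =>
      have h1 : constantCoeff E = 1 := by
        have := congrArg constantCoeff hE
        simpa using this
      rw [zero_add, pow_one, X_dvd_iff]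
      simp [h1]
    | succ L ihL =>
      have h1 : ∑ l ∈ Finset.range (L + 1 + 1), ((k + 1).multichoose l : PowerSeries ℝ) *
          (X * D) ^ l = ∑ l ∈ Finset.range (L + 1 + 1), (k.multichoose l : PowerSeries ℝ) *
          (X * D) ^ l + X * D * ∑ l ∈ Finset.range (L + 1),
            ((k + 1).multichoose l : PowerSeries ℝ) * (X * D) ^ l := by
        rw [Finset.sum_range_succ', Finset.sum_range_succ' _ (L + 1), Finset.mul_sum]
        simp only [Nat.multichoose_succ_succ, Nat.multichoose_zero_right, Nat.cast_add, add_mul,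
          Finset.sum_add_distrib]
        have : ∀ l, ((k + 1).multichoose l : PowerSeries ℝ) * (X * D) ^ (l + 1) =
          X * D * (((k + 1).multichoose l : PowerSeries ℝ) * (X * D) ^ l) := fun l => by ring
        simp only [this]
        ring
      have h2 : E ^ (k + 1) = E ^ k + X * D * E ^ (k + 1) := by
        linear_combination E ^ k * hE
      have h3 : E ^ (k + 1) - ∑ l ∈ Finset.range (L + 1 + 1),
          ((k + 1).multichoose l : PowerSeries ℝ) * (X * D) ^ l =
          (E ^ k - ∑ l ∈ Finset.range (L + 1 + 1), (k.multichoose l : PowerSeries ℝ) *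
            (X * D) ^ l) + D * (X * (E ^ (k + 1) - ∑ l ∈ Finset.range (L + 1),
              ((k + 1).multichoose l : PowerSeries ℝ) * (X * D) ^ l)) := by
        rw [h1]
        linear_combination h2
      rw [h3]
      refine dvd_add (ihk (L + 1)) (Dvd.dvd.mul_left ?_ D)
      rw [pow_succ' X (L + 1)]
      exact mul_dvd_mul_left X ihL

theorem coeff_inv_pow {D E : PowerSeries ℝ} (hE : E * (1 - X * D) = 1) (k n : ℕ) :
    coeff n (E ^ k) = ∑ l ∈ Finset.range (n + 1), (k.multichoose l : ℝ) * coeff (n - l) (D ^ l) := by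
  have h1 := X_pow_dvd_iff.mp (X_pow_dvd_inv_pow_sub hE k n) n (by omega)
  rw [map_sub, sub_eq_zero] at h1
  rw [h1, map_sum]
  refine Finset.sum_congr rfl fun l hl => ?_
  have hl' : l ≤ n := by simpa [Nat.lt_succ_iff] using hl
  obtain ⟨m, rfl⟩ := Nat.exists_eq_add_of_le' hl'
  rw [mul_pow, ← map_natCast (C : ℝ →+* PowerSeries ℝ), coeff_C_mul, coeff_X_pow_mul,
    Nat.add_sub_cancel]

theorem forestCount_eq (k n h : ℕ) :
    (forestCount k n h : ℝ) = 4 ^ n * coeff n (heightSeries h ^ k) := by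
  induction h generalizing k n with
  | zero =>
    rw [forestCount, heightSeries, one_pow, coeff_one]
    split_ifs with hn <;> simp [hn]
  | succ h ih =>
    have hE : heightSeries (h + 1) * (1 - X * (C (1 / 4) * heightSeries h)) = 1 := by
      linear_combination heightSeries_succ_mul h
    rw [coeff_inv_pow hE, forestCount, Finset.mul_sum, Fin.sum_univ_eq_sum_range
      (fun l => k.multichoose l * forestCount l (n - l) h), Nat.cast_sum]
    refine Finset.sum_congr rfl fun l hl => ?_
    have hl' : l ≤ n := by simpa [Nat.lt_succ_iff] using hl
    obtain ⟨m, rfl⟩ := Nat.exists_eq_add_of_le' hl'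
    rw [Nat.cast_mul, ih, Nat.add_sub_cancel, mul_pow, ← map_pow, coeff_C_mul, pow_add, div_pow,
      one_pow]
    field_simp

end Count

/-! ### Weights of cylinders and their limits. -/

/-- The number of edges up to level `r`. -/
def edgesUpTo (T : PlanarTree) (r : ℕ) : ℕ := ∑ s ∈ Finset.range r, T.levelCard (s + 1)

theorem size_eq_edgesUpTo (T : PlanarTree) {m : ℕ} (hm : T.levelCard (m + 1) = 0) :
    T.size = (T.edgesUpTo m : ℕ∞) := by
  have h : {p : ℕ × ℕ | p.2 < T.levelCard (p.1 + 1)} =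
      (((Finset.range m).sigma fun s => Finset.range (T.levelCard (s + 1))).map
        (Equiv.sigmaEquivProd ℕ ℕ).toEmbedding : Finset (ℕ × ℕ)) := by
    ext ⟨s, i⟩
    have hs : m ≤ s → T.levelCard (s + 1) = 0 := fun h =>
      T.levelCard_eq_zero_of_le (by omega) hm
    simp only [Set.mem_ofPred_eq, Finset.coe_map, Set.mem_image, Finset.mem_coe, Finset.mem_sigma,
      Finset.mem_range]
    constructor
    · intro hi
      refine ⟨⟨s, i⟩, ⟨?_, hi⟩, rfl⟩
      by_contra hms
      have h0 := hs (not_lt.mp hms)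
      omega
    · rintro ⟨⟨s', i'⟩, ⟨_, h2⟩, h3⟩
      cases h3
      exact h2
  rw [size_eq, h, Set.encard_coe_eq_coe_finsetCard, Finset.card_map, Finset.card_sigma, edgesUpTo]
  simp

theorem height_le_iff (T : PlanarTree) (m : ℕ) : T.height ≤ m ↔ T.levelCard (m + 1) = 0 := by
  rw [height, iSup₂_le_iff]
  constructor
  · intro h
    by_contra hne
    have := h (m + 1) hne
    rw [Nat.cast_le] at this
    omega
  · intro h r hr
    rw [Nat.cast_le]
    by_contra hlt
    exact hr (T.levelCard_eq_zero_of_le (by omega) h)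

theorem toNat_height_le_iff {N : ℕ} {T : PlanarTree} (hT : T ∈ ofSize N) (m : ℕ) :
    T.height.toNat ≤ m ↔ T.levelCard (m + 1) = 0 := by
  have h1 : T.height ≤ N := (T.height_le_iff N).mpr (levelCard_eq_zero_of_mem hT (by omega))
  have h2 : T.height ≠ ⊤ := ne_top_of_le_ne_top (ENat.natCast_ne_top N) h1
  rw [← height_le_iff, ← Nat.cast_le (α := ℕ∞), ENat.natCast_toNat h2]

/-- The geometric tail `∑_{m ≥ h(T)} exp (-μ m)`. It trades the exact height for height bounds,
which the generating series control. -/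
theorem hasSum_weight {μ : ℝ} (hμ : 0 < μ) {N : ℕ} {T : PlanarTree} (hT : T ∈ ofSize N) :
    HasSum (fun m : ℕ => if T.levelCard (m + 1) = 0 then Real.exp (-μ * m) else 0)
      (weight μ T / (1 - Real.exp (-μ))) := by
  set h := T.height.toNat with hh
  have hq : Real.exp (-μ) < 1 := by rw [← Real.exp_zero]; exact Real.exp_lt_exp.mpr (by linarith)
  have hgeom := (hasSum_geometric_of_lt_one (Real.exp_pos (-μ)).le hq).mul_left (weight μ T)
  have hiff := fun m => toNat_height_le_iff hT m
  rw [← div_eq_mul_inv] at hgeom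
  have h0 : ∑ m ∈ Finset.range h, (if T.levelCard (m + 1) = 0 then Real.exp (-μ * m) else 0) = 0 := by
    refine Finset.sum_eq_zero fun m hm => if_neg ?_
    rw [← hiff]
    have := Finset.mem_range.mp hm
    omega
  have h1 := (hasSum_nat_add_iff (f := fun m : ℕ =>
    if T.levelCard (m + 1) = 0 then Real.exp (-μ * m) else 0) h
    (g := weight μ T / (1 - Real.exp (-μ)))).mp ?_
  · rwa [h0, add_zero] at h1
  · have hfun : (fun n => if T.levelCard (n + h + 1) = 0 then Real.exp (-μ * ((n + h : ℕ) : ℝ))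
        else 0) = fun n => weight μ T * Real.exp (-μ) ^ n := by
      funext n
      rw [if_pos ((hiff _).mp (by omega)), weight, ← hh, ← Real.exp_nat_mul, ← Real.exp_add]
      push_cast
      ring_nf
    rw [hfun]
    exact hgeom

section Cylinder

open Classical in
/-- The total weight of the trees of size `N` with a given ball. -/
noncomputable def cylinderWeight (μ : ℝ) (N : ℕ) (T₀ : PlanarTree) (r : ℕ) : ℝ :=
  ∑ T ∈ (finite_ofSize N).toFinset with T.ball r = T₀, weight μ T

theorem mem_extensions_iff (T₀ : PlanarTree) (r n h : ℕ) (T : PlanarTree) :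
    T ∈ T₀.extensions r n h ↔
      (T ∈ ofSize (n + T₀.edgesUpTo r) ∧ T.ball r = T₀) ∧ T.levelCard (r + h + 1) = 0 := by
  have key : T.levelCard (r + h + 1) = 0 → T.ball r = T₀ →
      (T ∈ ofSize (n + T₀.edgesUpTo r) ↔
        ∑ i ∈ Finset.range h, T.levelCard (r + i + 1) = n) := by
    intro h1 h2
    have h3 : T.edgesUpTo r = T₀.edgesUpTo r := by
      refine Finset.sum_congr rfl fun s hs => ?_
      rw [← h2, levelCard_ball]
      have := Finset.mem_range.mp hs
      omega
    rw [ofSize, Set.mem_ofPred_eq, T.size_eq_edgesUpTo h1, Nat.cast_inj, edgesUpTo,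
      Finset.sum_range_add, ← edgesUpTo, h3]
    omega
  constructor
  · rintro ⟨h1, h2, h3⟩
    exact ⟨⟨(key h2 h1).mpr h3, h1⟩, h2⟩
  · rintro ⟨⟨h1, h2⟩, h3⟩
    exact ⟨h2, h3, (key h3 h2).mp h1⟩

theorem cylinderWeight_eq {μ : ℝ} (hμ : 0 < μ) {T₀ : PlanarTree} {r : ℕ} (hr : 1 ≤ r)
    (hT : T₀.ball r = T₀) (hk : 1 ≤ T₀.levelCard r) (n : ℕ) :
    cylinderWeight μ (n + T₀.edgesUpTo r) T₀ r =
      (1 - Real.exp (-μ)) * Real.exp (-μ * r) * 4 ^ n * heightSum μ (T₀.levelCard r) n := by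
  classical
  have hq : Real.exp (-μ) < 1 := by rw [← Real.exp_zero]; exact Real.exp_lt_exp.mpr (by linarith)
  set F := (finite_ofSize (n + T₀.edgesUpTo r)).toFinset.filter (fun T => T.ball r = T₀) with hF
  have hmem : ∀ T ∈ F, T ∈ ofSize (n + T₀.edgesUpTo r) ∧ T.ball r = T₀ := by
    intro T hTF
    rw [hF, Finset.mem_filter, Set.Finite.mem_toFinset] at hTF
    exact hTF
  have h1 := hasSum_sum fun T hTF => hasSum_weight hμ (hmem T hTF).1
  rw [← Finset.sum_div] at h1
  set f : ℕ → ℝ := fun m => ∑ T ∈ F, if T.levelCard (m + 1) = 0 then Real.exp (-μ * m) else 0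
    with hf
  -- Level `r` is nonempty, so no tree in the cylinder has height below `r`; the sum may start at `m
  -- = r`.
  have hzero : ∑ m ∈ Finset.range r, f m = 0 := by
    refine Finset.sum_eq_zero fun m hm => Finset.sum_eq_zero fun T hTF => if_neg fun h0 => ?_
    have h2 := T.levelCard_eq_zero_of_le (Nat.succ_le_of_lt (Finset.mem_range.mp hm)) h0
    rw [← levelCard_ball T le_rfl, (hmem T hTF).2] at h2
    omega
  have hshift : ∀ h : ℕ, f (h + r) = Real.exp (-μ * r) * 4 ^ n *
      (Real.exp (-μ * h) * PowerSeries.coeff n (heightSeries h ^ T₀.levelCard r)) := by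
    intro h
    have hset : T₀.extensions r n h = ↑(F.filter fun T => T.levelCard (h + r + 1) = 0) := by
      ext T
      rw [mem_extensions_iff, Finset.coe_filter, hF, Set.mem_ofPred_eq, Finset.mem_filter,
        Set.Finite.mem_toFinset, add_comm r h]
    have hcard := (finite_and_natCard_extensions T₀ hr hT n h).2
    rw [hset, Nat.card_coe_set_eq, Set.ncard_coe_finset] at hcard
    rw [hf]
    simp only
    rw [← Finset.sum_filter, Finset.sum_const, hcard, nsmul_eq_mul, forestCount_eq]
    have : Real.exp (-μ * ((h + r : ℕ) : ℝ)) = Real.exp (-μ * r) * Real.exp (-μ * h) := by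
      rw [← Real.exp_add]; push_cast; ring_nf
    rw [this]
    ring
  have h2 : HasSum (fun h => f (h + r)) ((∑ T ∈ F, weight μ T) / (1 - Real.exp (-μ))) := by
    rw [hasSum_nat_add_iff, hzero, add_zero]
    exact h1
  simp only [hshift] at h2
  have h3 := h2.tsum_eq
  rw [tsum_mul_left] at h3
  have h4 : 1 - Real.exp (-μ) ≠ 0 := by linarith
  rw [cylinderWeight, heightSum]
  rw [eq_div_iff h4] at h3
  linarith

/-- A tree whose ball is already extinct at level `r` equals that ball, so it cannot have `n`
further edges. -/
theorem cylinderWeight_eq_zero (μ : ℝ) {T₀ : PlanarTree} {r : ℕ}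
    (hk : T₀.levelCard r = 0) {n : ℕ} (hn : 0 < n) :
    cylinderWeight μ (n + T₀.edgesUpTo r) T₀ r = 0 := by
  classical
  refine Finset.sum_eq_zero fun T hTF => ?_
  exfalso
  rw [Finset.mem_filter, Set.Finite.mem_toFinset] at hTF
  have h1 : T.levelCard (r + 0 + 1) = 0 := by
    refine T.levelCard_eq_zero_of_le (show r ≤ r + 0 + 1 by omega) ?_
    rw [← levelCard_ball T le_rfl, hTF.2, hk]
  have h2 := (mem_extensions_iff T₀ r n 0 T).mpr ⟨hTF, h1⟩
  have := h2.2.2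
  simp at this
  omega

/-- All trees share the same ball of radius `1`, a single edge, so the partition function is itself
a cylinder weight. -/
theorem partitionFunction_eq {μ : ℝ} (hμ : 0 < μ) (n : ℕ) :
    partitionFunction μ (n + 1) =
      (1 - Real.exp (-μ)) * Real.exp (-μ) * 4 ^ n * heightSum μ 1 n := by
  classical
  have h1 : (path 1).levelCard 1 = 1 := levelCard_one _
  have h2 : (path 1).edgesUpTo 1 = 1 := by simp [edgesUpTo, h1]
  have h3 := cylinderWeight_eq hμ (T₀ := path 1) le_rfl
    ((ball_eq_self_iff _ le_rfl).mpr (by simp [path])) h1.ge n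
  rw [h1, h2, Nat.cast_one, mul_one] at h3
  rw [← h3, partitionFunction, cylinderWeight, Finset.filter_true_of_mem]
  intro T _
  rw [ball_one_eq T (path 1), ball_eq_self_iff _ le_rfl]
  simp [path]

/-- The limiting probability of a cylinder. -/
noncomputable def cylinderLimit (μ : ℝ) (T₀ : PlanarTree) (r : ℕ) : ℝ :=
  Real.exp (-μ * ((r : ℝ) - 1)) * (1 / 4) ^ (T₀.edgesUpTo r - 1) *
    limitWeight μ (T₀.levelCard r)

theorem one_le_edgesUpTo (T : PlanarTree) {r : ℕ} (hr : 1 ≤ r) : 1 ≤ T.edgesUpTo r := by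
  rw [edgesUpTo]
  refine le_trans (le_of_eq ?_) (Finset.single_le_sum (f := fun s => T.levelCard (s + 1))
    (fun _ _ => Nat.zero_le _) (Finset.mem_range.mpr hr))
  simp [T.levelCard_one]

theorem tendsto_cylinderWeight_div {μ : ℝ} (hμ : 0 < μ) {T₀ : PlanarTree} {r : ℕ} (hr : 1 ≤ r)
    (hT : T₀.ball r = T₀) :
    Tendsto (fun N => cylinderWeight μ N T₀ r / partitionFunction μ N) atTop
      (𝓝 (cylinderLimit μ T₀ r)) := by
  obtain ⟨e, he⟩ := Nat.exists_eq_add_of_le' (T₀.one_le_edgesUpTo hr)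
  rw [← tendsto_add_atTop_iff_nat (T₀.edgesUpTo r)]
  rcases Nat.eq_zero_or_pos (T₀.levelCard r) with hk | hk
  · rw [cylinderLimit, hk, limitWeight]
    simp only [Finset.range_zero, Finset.sum_empty, mul_zero, zero_div]
    refine tendsto_const_nhds.congr' ?_
    filter_upwards [eventually_gt_atTop 0] with n hn
    rw [cylinderWeight_eq_zero μ hk hn, zero_div]
  · have h1 := (tendsto_heightSum_div hμ (T₀.levelCard r) 0 e hk).const_mul
      (Real.exp (-μ * ((r : ℝ) - 1)) * (1 / 4) ^ (T₀.edgesUpTo r - 1))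
    rw [← cylinderLimit] at h1
    refine h1.congr fun n => ?_
    have hq : Real.exp (-μ) < 1 := by
      rw [← Real.exp_zero]; exact Real.exp_lt_exp.mpr (by linarith)
    rw [cylinderWeight_eq hμ hr hT hk, he, ← add_assoc, partitionFunction_eq hμ, add_zero,
      Nat.add_sub_cancel]
    have h2 : Real.exp (-μ * r) = Real.exp (-μ * ((r : ℝ) - 1)) * Real.exp (-μ) := by
      rw [← Real.exp_add]; ring_nf
    have h3 : (1 : ℝ) - Real.exp (-μ) ≠ 0 := by linarith
    rw [h2, pow_add, div_pow, one_pow]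
    have h4 := Real.exp_ne_zero (-μ)
    field_simp

end Cylinder

/-! ### Summation over generations: total mass and mean level size of the limit. -/

section Binomial

theorem tsum_multichoose_mul_half_pow (d : ℕ) :
    ∑' m : ℕ, (d.multichoose m : ℝ≥0∞) * (1 / 2) ^ m = 2 ^ d := by
  cases d with
  | zero =>
    rw [tsum_eq_single 0]
    · simp
    · intro m hm
      obtain ⟨m, rfl⟩ := Nat.exists_eq_succ_of_ne_zero hm
      simp
  | succ d =>
    have h1 : HasSum (fun m : ℕ => ((m + d).choose d : ℝ) * (1 / 2) ^ m) (1 / (1 - 1 / 2) ^ (d + 1)) :=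
      hasSum_choose_mul_geometric_of_norm_lt_one d (by norm_num)
    have h2 := ENNReal.ofReal_tsum_of_nonneg (fun m => by positivity) h1.summable
    rw [h1.tsum_eq] at h2
    have h3 : ENNReal.ofReal (1 / (1 - 1 / 2) ^ (d + 1)) = 2 ^ (d + 1) := by
      rw [show (1 / (1 - 1 / 2) ^ (d + 1) : ℝ) = 2 ^ (d + 1) by
        rw [← one_div_pow]; norm_num, ENNReal.ofReal_pow (by norm_num)]
      norm_num
    rw [← h3, h2]
    refine tsum_congr fun m => ?_
    rw [ENNReal.ofReal_mul (by positivity), ENNReal.ofReal_natCast,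
      ENNReal.ofReal_pow (by norm_num), Nat.multichoose_eq,
      show d + 1 + m - 1 = m + d by omega, Nat.choose_symm_add]
    congr 2
    rw [ENNReal.ofReal_div_of_pos (by norm_num)]
    simp

theorem multichoose_mul_choose (k j m : ℕ) :
    k.multichoose (j + m) * (j + m).choose j = k.multichoose j * (k + j).multichoose m := by
  cases k with
  | zero =>
    cases j with
    | zero => simp
    | succ j => rw [show j + 1 + m = (j + m) + 1 by ring]; simp
  | succ k =>
    rw [Nat.multichoose_eq, Nat.multichoose_eq, Nat.multichoose_eq, Nat.choose_symm_add,
      Nat.choose_mul (by omega), mul_comm]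
    congr 2 <;> omega

/-- Binomial moments of a sum of `k` independent geometric variables of parameter `1/2`, that is, of
one generation of a critical geometric branching process. The product identity
`multichoose_mul_choose` reduces them to total masses. -/
theorem tsum_multichoose_mul_choose (k j : ℕ) :
    ∑' l : ℕ, (k.multichoose l : ℝ≥0∞) * (1 / 2) ^ l * (l.choose j : ℝ≥0∞) =
      2 ^ k * k.multichoose j := by
  rw [← ENNReal.summable.sum_add_tsum_nat_add' (f := fun l : ℕ =>
    (k.multichoose l : ℝ≥0∞) * (1 / 2) ^ l * (l.choose j : ℝ≥0∞)) (k := j),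
    Finset.sum_eq_zero, zero_add]
  · have h1 : ∀ m : ℕ, (k.multichoose (m + j) : ℝ≥0∞) * (1 / 2) ^ (m + j) *
        ((m + j).choose j : ℝ≥0∞) =
        k.multichoose j * (1 / 2) ^ j * (((k + j).multichoose m : ℝ≥0∞) * (1 / 2) ^ m) := by
      intro m
      have h2 : (k.multichoose (j + m) : ℝ≥0∞) * ((j + m).choose j : ℝ≥0∞) =
        k.multichoose j * (k + j).multichoose m := by
        exact_mod_cast multichoose_mul_choose k j m
      rw [add_comm m j, mul_right_comm, h2, pow_add]
      ring
    simp only [h1]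
    rw [ENNReal.tsum_mul_left, tsum_multichoose_mul_half_pow, pow_add]
    have h3 : ((1 / 2 : ℝ≥0∞)) ^ j * 2 ^ j = 1 := by
      rw [← mul_pow, one_div, ENNReal.inv_mul_cancel (by norm_num) (by norm_num), one_pow]
    calc _ = ((1 / 2 : ℝ≥0∞) ^ j * 2 ^ j) * (2 ^ k * k.multichoose j) := by ring
      _ = _ := by rw [h3, one_mul]
  · intro l hl
    rw [Nat.choose_eq_zero_of_lt (Finset.mem_range.mp hl)]
    simp

/-- Vandermonde's identity, which re-expands the binomial moments in the basis used by
`binomialSeries`. -/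
theorem multichoose_succ_eq_sum (k n : ℕ) :
    k.multichoose (n + 1) = ∑ i ∈ Finset.range (n + 1), n.choose i * k.choose (i + 1) := by
  rw [Nat.multichoose_eq, show k + (n + 1) - 1 = k + n by omega, Nat.add_choose_eq,
    Finset.Nat.sum_antidiagonal_eq_sum_range_succ (fun a b => k.choose a * n.choose b),
    Finset.sum_range_succ']
  simp only [Nat.sub_zero, Nat.choose_succ_self, mul_zero, add_zero]
  refine Finset.sum_congr rfl fun i hi => ?_
  have hi' : i ≤ n := by simpa [Nat.lt_succ_iff] using hi
  rw [show n + 1 - (i + 1) = n - i by omega, Nat.choose_symm hi', mul_comm]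

end Binomial

/-- Combinations of the functions `l ↦ 2 ^ l * l.choose (n + 1)`. -/
noncomputable def binomialSeries (β : ℕ → ℝ≥0∞) (l : ℕ) : ℝ≥0∞ :=
  2 ^ l * ∑' n, β n * (l.choose (n + 1) : ℝ≥0∞)

/-- The action of one generation of offspring on the coefficients of `binomialSeries`. -/
noncomputable def binomialShift (β : ℕ → ℝ≥0∞) (i : ℕ) : ℝ≥0∞ :=
  ∑' n, β n * (n.choose i : ℝ≥0∞)

theorem tsum_multichoose_mul_binomialSeries (β : ℕ → ℝ≥0∞) (k : ℕ) :
    ∑' l : ℕ, (k.multichoose l : ℝ≥0∞) * ((1 / 4) ^ l * binomialSeries β l) =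
      binomialSeries (binomialShift β) k := by
  have h1 : ∀ l : ℕ, (1 / 4 : ℝ≥0∞) ^ l * 2 ^ l = (1 / 2) ^ l := by
    intro l
    rw [← mul_pow]
    congr 1
    rw [show (4 : ℝ≥0∞) = 2 * 2 by norm_num, one_div, one_div,
      ENNReal.mul_inv (by norm_num) (by norm_num), mul_assoc,
      ENNReal.inv_mul_cancel (by norm_num) (by norm_num), mul_one]
  have h2 : ∀ l : ℕ, (k.multichoose l : ℝ≥0∞) * ((1 / 4) ^ l * binomialSeries β l) =
      ∑' n, β n * ((k.multichoose l : ℝ≥0∞) * (1 / 2) ^ l * (l.choose (n + 1) : ℝ≥0∞)) := by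
    intro l
    rw [binomialSeries, ← mul_assoc (_ ^ l), h1, ← mul_assoc, ← ENNReal.tsum_mul_left]
    exact tsum_congr fun n => by ring
  simp only [h2]
  rw [ENNReal.tsum_comm]
  have h3 : ∀ n, ∑' l : ℕ, β n * ((k.multichoose l : ℝ≥0∞) * (1 / 2) ^ l *
      (l.choose (n + 1) : ℝ≥0∞)) =
      2 ^ k * ∑' i, β n * (n.choose i : ℝ≥0∞) * (k.choose (i + 1) : ℝ≥0∞) := by
    intro n
    rw [ENNReal.tsum_mul_left, tsum_multichoose_mul_choose, multichoose_succ_eq_sum,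
      tsum_eq_sum (s := Finset.range (n + 1))]
    · push_cast
      rw [mul_left_comm, Finset.mul_sum]
      congr 1
      exact Finset.sum_congr rfl fun i _ => by ring
    · intro i hi
      rw [Nat.choose_eq_zero_of_lt (by simpa using hi)]
      simp
  simp only [h3]
  rw [ENNReal.tsum_mul_left, binomialSeries, ENNReal.tsum_comm]
  congr 1
  refine tsum_congr fun i => ?_
  rw [ENNReal.tsum_mul_right, binomialShift]

/-- The trees of height at most `r`. -/
abbrev BallTree (r : ℕ) := {T : PlanarTree // T.ball r = T}

/-- The sum of a function of the size of the last level over the trees of height at most `r`,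
weighted by the size of the tree. -/
noncomputable def levelSum (r : ℕ) (φ : ℕ → ℝ≥0∞) : ℝ≥0∞ :=
  ∑' T : BallTree r, (1 / 4) ^ (T.1.edgesUpTo r - 1) * φ (T.1.levelCard r)

theorem levelSum_one (φ : ℕ → ℝ≥0∞) : levelSum 1 φ = φ 1 := by
  have h0 : (path 1).ball 1 = path 1 := (ball_eq_self_iff _ le_rfl).mpr (by simp [path])
  rw [levelSum, tsum_eq_single ⟨path 1, h0⟩]
  · simp [edgesUpTo, levelCard_one]
  · rintro ⟨T, hT⟩ hne
    refine absurd (Subtype.ext ?_) hne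
    exact hT.symm.trans ((ball_one_eq T (path 1)).trans h0)

/-- A tree of height at most `r + 1` is a tree of height at most `r` with one more level. -/
noncomputable def ballTreeSuccEquiv (r : ℕ) (hr : 1 ≤ r) :
    (Σ T : BallTree r, Σ l : ℕ, (Fin l →o Fin (T.1.levelCard r))) ≃ BallTree (r + 1) :=
  Equiv.ofBijective (fun p => ⟨p.1.1.extend r hr p.2.2, ball_succ_extend _ r hr _⟩) (by
    constructor
    · rintro ⟨⟨T, hT⟩, p⟩ ⟨⟨T', hT'⟩, p'⟩ heq
      have h1 : T.extend r hr p.2 = T'.extend r hr p'.2 := congrArg Subtype.val heq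
      have h2 := congrArg (fun S => ball S r) h1
      simp only [ball_extend] at h2
      rw [hT, hT'] at h2
      subst h2
      rw [T.extend_injective r hr h1]
    · rintro ⟨S, hS⟩
      obtain ⟨f, hf⟩ := (S.ball r).exists_extend_eq r hr rfl
      exact ⟨⟨⟨S.ball r, S.ball_ball le_rfl⟩, _, f⟩, Subtype.ext (hf.trans hS)⟩)

theorem levelSum_succ {r : ℕ} (hr : 1 ≤ r) (φ : ℕ → ℝ≥0∞) :
    levelSum (r + 1) φ =
      levelSum r fun k => ∑' l : ℕ, (k.multichoose l : ℝ≥0∞) * ((1 / 4) ^ l * φ l) := by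
  rw [levelSum, ← (ballTreeSuccEquiv r hr).tsum_eq, ENNReal.tsum_sigma', levelSum]
  refine tsum_congr fun T => ?_
  rw [ENNReal.tsum_sigma', ← ENNReal.tsum_mul_left]
  refine tsum_congr fun l => ?_
  have := Fintype.ofFinite (Fin l →o Fin (T.1.levelCard r))
  have h1 : ∀ f : Fin l →o Fin (T.1.levelCard r),
      (1 / 4 : ℝ≥0∞) ^ ((T.1.extend r hr f).edgesUpTo (r + 1) - 1) *
        φ ((T.1.extend r hr f).levelCard (r + 1)) =
      (1 / 4) ^ (T.1.edgesUpTo r - 1) * ((1 / 4) ^ l * φ l) := by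
    intro f
    have h2 : (T.1.extend r hr f).edgesUpTo (r + 1) = T.1.edgesUpTo r + l := by
      rw [edgesUpTo, Finset.sum_range_succ, levelCard_extend, edgesUpTo]
      congr 1
      refine Finset.sum_congr rfl fun s hs => levelCard_extend_of_le _ _ _ _ ?_
      exact Finset.mem_range.mp hs
    have h3 := T.1.one_le_edgesUpTo hr
    rw [h2, levelCard_extend, show T.1.edgesUpTo r + l - 1 = T.1.edgesUpTo r - 1 + l by omega,
      pow_add, mul_assoc]
  refine (tsum_congr h1).trans ?_
  rw [tsum_fintype, Finset.sum_const, Finset.card_univ, ← Nat.card_eq_fintype_card,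
    natCard_orderHom_fin, nsmul_eq_mul]
  ring

/-- With `β(x) = ∑ β_n x ^ n`, `binomialShift` produces the coefficients of `β(x + 1)`. After `R`
generations from the single vertex at level `1`, where the value is `2 β(0)`, one obtains `2 β(R)`.
-/
theorem levelSum_binomialSeries (R : ℕ) (β : ℕ → ℝ≥0∞) :
    levelSum (R + 1) (binomialSeries β) = 2 * ∑' n, β n * (R : ℝ≥0∞) ^ n := by
  induction R generalizing β with
  | zero =>
    rw [levelSum_one, binomialSeries, tsum_eq_single 0, tsum_eq_single 0]
    · simp
    · intro n hn
      simp [hn]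
    · intro n hn
      rw [Nat.choose_eq_zero_of_lt (by omega)]
      simp
  | succ R ih =>
    rw [levelSum_succ (by omega)]
    simp only [tsum_multichoose_mul_binomialSeries]
    rw [ih]
    congr 1
    simp only [binomialShift, ← ENNReal.tsum_mul_right]
    rw [ENNReal.tsum_comm]
    refine tsum_congr fun n => ?_
    rw [tsum_eq_sum (s := Finset.range (n + 1))]
    · push_cast
      rw [add_pow, Finset.mul_sum]
      exact Finset.sum_congr rfl fun i _ => by rw [one_pow]; ring
    · intro i hi
      rw [Nat.choose_eq_zero_of_lt (by simpa using hi)]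
      simp

/-- The coefficients of the exponential function. -/
noncomputable def expCoeff (μ : ℝ) (n : ℕ) : ℝ≥0∞ := ENNReal.ofReal (μ ^ n / (n.factorial : ℝ))

theorem ofReal_limitWeight {μ : ℝ} (hμ : 0 < μ) (k : ℕ) :
    ENNReal.ofReal (limitWeight μ k) = binomialSeries (expCoeff μ) k / 2 := by
  rw [limitWeight, ENNReal.ofReal_div_of_pos (by norm_num), ENNReal.ofReal_ofNat, binomialSeries,
    ENNReal.ofReal_mul (by positivity), ENNReal.ofReal_pow (by norm_num), ENNReal.ofReal_ofNat,
    ENNReal.ofReal_sum_of_nonneg fun i _ => by positivity, tsum_eq_sum (s := Finset.range k)]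
  · congr 2
    refine Finset.sum_congr rfl fun i _ => ?_
    rw [mul_div_assoc, ENNReal.ofReal_mul (by positivity), ENNReal.ofReal_natCast, expCoeff,
      mul_comm]
  · intro i hi
    rw [Nat.choose_eq_zero_of_lt (by simpa [Nat.lt_succ_iff] using hi)]
    simp

theorem tsum_cylinderLimit_mul {μ : ℝ} (hμ : 0 < μ) (R : ℕ) (f : ℕ → ℝ≥0∞) :
    ∑' T : BallTree (R + 1), ENNReal.ofReal (cylinderLimit μ T.1 (R + 1)) *
      f (T.1.levelCard (R + 1)) =
    ENNReal.ofReal (Real.exp (-μ * R)) *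
      (levelSum (R + 1) (fun k => f k * binomialSeries (expCoeff μ) k) / 2) := by
  rw [levelSum, div_eq_mul_inv, ← ENNReal.tsum_mul_right, ← ENNReal.tsum_mul_left]
  refine tsum_congr fun T => ?_
  have h1 : (0 : ℝ) ≤ (1 / 4) ^ (T.1.edgesUpTo (R + 1) - 1) := by positivity
  rw [cylinderLimit, ENNReal.ofReal_mul (by positivity), ENNReal.ofReal_mul (by positivity),
    ofReal_limitWeight hμ, ENNReal.ofReal_pow (by norm_num), ENNReal.ofReal_div_of_pos (by norm_num),
    ENNReal.ofReal_one, ENNReal.ofReal_ofNat, div_eq_mul_inv (binomialSeries _ _)]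
  push_cast
  rw [add_sub_cancel_right]
  ring

theorem hasSum_exp_moments (x : ℝ) :
    HasSum (fun n : ℕ => x ^ n / (n.factorial : ℝ)) (Real.exp x) ∧
      HasSum (fun n : ℕ => (n : ℝ) * (x ^ n / (n.factorial : ℝ))) (x * Real.exp x) := by
  have h1 : HasSum (fun n : ℕ => x ^ n / (n.factorial : ℝ)) (Real.exp x) := by
    rw [Real.exp_eq_exp_ℝ]
    exact NormedSpace.expSeries_div_hasSum_exp x
  refine ⟨h1, ?_⟩
  rw [← hasSum_nat_add_iff' 1]
  simp only [Finset.range_one, Finset.sum_singleton, Nat.cast_zero, zero_mul, sub_zero]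
  have h2 : (fun n : ℕ => ((n + 1 : ℕ) : ℝ) * (x ^ (n + 1) / ((n + 1).factorial : ℝ))) =
      fun n => x * (x ^ n / (n.factorial : ℝ)) := by
    funext n
    rw [Nat.factorial_succ]
    push_cast
    have : (n.factorial : ℝ) ≠ 0 := by positivity
    field_simp
    ring
  rw [h2]
  exact h1.mul_left x

/-- For `β(x) = exp (μ x)` the level sum contributes `exp (μ R)`, which cancels the prefactor `exp
(-μ R)`. This conservation of mass is what yields tightness. -/
theorem tsum_cylinderLimit {μ : ℝ} (hμ : 0 < μ) (R : ℕ) :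
    ∑' T : BallTree (R + 1), ENNReal.ofReal (cylinderLimit μ T.1 (R + 1)) = 1 := by
  have h1 := tsum_cylinderLimit_mul hμ R fun _ => 1
  simp only [mul_one, one_mul] at h1
  have hx : 0 ≤ μ * R := by positivity
  rw [h1, levelSum_binomialSeries]
  have h2 : ∑' n, expCoeff μ n * (R : ℝ≥0∞) ^ n = ENNReal.ofReal (Real.exp (μ * R)) := by
    rw [← (hasSum_exp_moments (μ * R)).1.tsum_eq, ENNReal.ofReal_tsum_of_nonneg
      (fun n => by positivity) (hasSum_exp_moments (μ * R)).1.summable]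
    refine tsum_congr fun n => ?_
    rw [expCoeff, ← ENNReal.ofReal_natCast R, ← ENNReal.ofReal_pow (by positivity),
      ← ENNReal.ofReal_mul (by positivity)]
    congr 1
    rw [mul_pow]; ring
  rw [h2, mul_div_assoc, ENNReal.mul_div_cancel (by norm_num) (by norm_num),
    ← ENNReal.ofReal_mul (by positivity), ← Real.exp_add]
  simp

/-- Multiplication by the index, on the coefficients of `binomialSeries`. -/
noncomputable def binomialIndexMul (β : ℕ → ℝ≥0∞) : ℕ → ℝ≥0∞
  | 0 => β 0
  | n + 1 => ((n : ℝ≥0∞) + 2) * (β (n + 1) + β n)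

/-- From `l C(l, n+1) = (n+1) C(l, n+1) + (n+2) C(l, n+2)`. On generating functions the operation is
`β ↦ (x (1 + x) β)'`. -/
theorem natCast_mul_binomialSeries (β : ℕ → ℝ≥0∞) (l : ℕ) :
    (l : ℝ≥0∞) * binomialSeries β l = binomialSeries (binomialIndexMul β) l := by
  have h1 : ∀ n, l * l.choose (n + 1) = (n + 1) * l.choose (n + 1) + (n + 2) * l.choose (n + 2) := by
    intro n
    have := Nat.choose_succ_right_eq l (n + 1)
    rcases Nat.lt_or_ge l (n + 1) with h | h
    · simp [Nat.choose_eq_zero_of_lt h, Nat.choose_eq_zero_of_lt (show l < n + 2 by omega)]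
    · obtain ⟨m, rfl⟩ := Nat.exists_eq_add_of_le h
      rw [Nat.add_sub_cancel_left] at this
      rw [show n + 2 = n + 1 + 1 by ring]
      linarith
  have h2 : ∀ n, (l : ℝ≥0∞) * (l.choose (n + 1) : ℝ≥0∞) = ((n : ℝ≥0∞) + 1) * l.choose (n + 1) +
      ((n : ℝ≥0∞) + 2) * l.choose (n + 2) := fun n => by exact_mod_cast h1 n
  have h3 : ∑' n, binomialIndexMul β n * (l.choose (n + 1) : ℝ≥0∞) =
      ∑' n, β n * (((n : ℝ≥0∞) + 1) * l.choose (n + 1)) +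
        ∑' n, β n * (((n : ℝ≥0∞) + 2) * l.choose (n + 2)) := by
    rw [tsum_eq_zero_add' ENNReal.summable,
      tsum_eq_zero_add' (f := fun n => β n * (((n : ℝ≥0∞) + 1) * l.choose (n + 1)))
        ENNReal.summable, add_assoc, ← ENNReal.tsum_add]
    congr 1
    · simp [binomialIndexMul]
    · refine tsum_congr fun n => ?_
      rw [binomialIndexMul]
      push_cast
      ring
  rw [binomialSeries, binomialSeries, h3, mul_left_comm, ← ENNReal.tsum_add,
    ← ENNReal.tsum_mul_left]
  congr 1
  refine tsum_congr fun n => ?_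
  rw [mul_left_comm, h2]
  ring

/-- The mean is `exp (-μ R)` times the derivative of `x (1 + x) exp (μ x)` at `x = R`; it is
evaluated through the series of `exp` and its first moment. -/
theorem tsum_cylinderLimit_mul_levelCard {μ : ℝ} (hμ : 0 < μ) (R : ℕ) :
    ∑' T : BallTree (R + 1), ENNReal.ofReal (cylinderLimit μ T.1 (R + 1)) *
      (T.1.levelCard (R + 1) : ℝ≥0∞) =
    ENNReal.ofReal (1 + 2 * R + μ * R * (R + 1)) := by
  rw [tsum_cylinderLimit_mul hμ R fun k => (k : ℝ≥0∞)]
  simp only [natCast_mul_binomialSeries]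
  rw [levelSum_binomialSeries]
  obtain ⟨s0, s1⟩ := hasSum_exp_moments (μ * R)
  have hs := (s1.add s0).add ((s1.add (s0.mul_left 2)).mul_left (R : ℝ))
  have h2 : ∑' n, binomialIndexMul (expCoeff μ) n * (R : ℝ≥0∞) ^ n =
      ENNReal.ofReal ((1 + 2 * R + μ * R * (R + 1)) * Real.exp (μ * R)) := by
    have e : (1 + 2 * R + μ * R * (R + 1)) * Real.exp (μ * R) =
      μ * R * Real.exp (μ * R) + Real.exp (μ * R) +
        R * (μ * R * Real.exp (μ * R) + 2 * Real.exp (μ * R)) := by ring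
    have hmul : ∀ n m : ℕ, expCoeff μ n * (R : ℝ≥0∞) ^ m =
        ENNReal.ofReal (μ ^ n / (n.factorial : ℝ) * (R : ℝ) ^ m) := by
      intro n m
      rw [expCoeff, ← ENNReal.ofReal_natCast R, ← ENNReal.ofReal_pow (by positivity),
        ← ENNReal.ofReal_mul (by positivity)]
    have h3 : ∑' n, binomialIndexMul (expCoeff μ) n * (R : ℝ≥0∞) ^ n =
        ∑' n : ℕ, ((n : ℝ≥0∞) + 1) * (expCoeff μ n * (R : ℝ≥0∞) ^ n) +
          ∑' n : ℕ, ((n : ℝ≥0∞) + 2) * (expCoeff μ n * (R : ℝ≥0∞) ^ (n + 1)) := by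
      rw [tsum_eq_zero_add' ENNReal.summable,
        tsum_eq_zero_add' (f := fun n : ℕ => ((n : ℝ≥0∞) + 1) * (expCoeff μ n * (R : ℝ≥0∞) ^ n))
          ENNReal.summable, add_assoc, ← ENNReal.tsum_add]
      congr 1
      · simp [binomialIndexMul]
      · refine tsum_congr fun n => ?_
        rw [binomialIndexMul]
        push_cast
        ring
    rw [e, ← hs.tsum_eq, ENNReal.ofReal_tsum_of_nonneg (fun n => by positivity) hs.summable, h3,
      ← ENNReal.tsum_add]
    refine tsum_congr fun n => ?_
    have e1 : ((n : ℝ≥0∞) + 1) = ENNReal.ofReal ((n : ℝ) + 1) := by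
      rw [ENNReal.ofReal_add (by positivity) (by norm_num)]; simp
    have e2 : ((n : ℝ≥0∞) + 2) = ENNReal.ofReal ((n : ℝ) + 2) := by
      rw [ENNReal.ofReal_add (by positivity) (by norm_num)]; simp
    rw [hmul, hmul, e1, e2, ← ENNReal.ofReal_mul (by positivity),
      ← ENNReal.ofReal_mul (by positivity), ← ENNReal.ofReal_add (by positivity) (by positivity)]
    congr 1
    rw [mul_pow]
    ring
  rw [h2, mul_div_assoc, ENNReal.mul_div_cancel (by norm_num) (by norm_num),
    ← ENNReal.ofReal_mul (by positivity)]
  congr 1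
  have : Real.exp (-μ * R) * Real.exp (μ * R) = 1 := by rw [← Real.exp_add]; simp
  linear_combination (1 + 2 * R + μ * R * (R + 1)) * this

/-! ### Topology of the space of trees: cylinders, separability, compact sets. -/

theorem ball_eq_of_dist_lt {T T' : PlanarTree} {r : ℕ} (hr : 1 ≤ r)
    (h : dist T T' < 1 / (r : ℝ)) : T.ball r = T'.ball r := by
  obtain ⟨a, ⟨s, hs, hss, rfl⟩, hlt⟩ := exists_lt_of_csInf_lt (agreement_nonempty T T') h
  refine ball_eq_of_le ?_ hss
  have hs0 : (0 : ℝ) < s := by exact_mod_cast hs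
  have hr0 : (0 : ℝ) < r := by exact_mod_cast hr
  have := (one_div_lt_one_div hs0 hr0).mp hlt
  exact le_of_lt (by exact_mod_cast this)

theorem dist_le_of_ball_eq {T T' : PlanarTree} {r : ℕ} (hr : 1 ≤ r) (h : T.ball r = T'.ball r) :
    dist T T' ≤ 1 / (r : ℝ) :=
  csInf_le (agreement_bddBelow T T') ⟨r, hr, h, rfl⟩

theorem isLocallyConstant_ball {r : ℕ} (hr : 1 ≤ r) :
    IsLocallyConstant fun T : PlanarTree => T.ball r := by
  rw [IsLocallyConstant.iff_eventually_eq]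
  intro T
  have hr0 : (0 : ℝ) < 1 / r := by
    have : (0 : ℝ) < r := by exact_mod_cast hr
    positivity
  filter_upwards [Metric.ball_mem_nhds T hr0] with T' hT'
  exact ball_eq_of_dist_lt hr hT'

/-- The trees with a given ball. -/
def cylinder (T₀ : PlanarTree) (r : ℕ) : Set PlanarTree := {T | T.ball r = T₀}

theorem isClopen_cylinder (T₀ : PlanarTree) {r : ℕ} (hr : 1 ≤ r) : IsClopen (T₀.cylinder r) :=
  (isLocallyConstant_ball hr).isClopen_fiber T₀

theorem isLocallyConstant_levelCard (r : ℕ) :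
    IsLocallyConstant fun T : PlanarTree => T.levelCard r := by
  have h : (fun T : PlanarTree => T.levelCard r) =
      (fun T : PlanarTree => T.levelCard r) ∘ fun T => T.ball (r + 1) := by
    funext T
    exact (levelCard_ball T (by omega)).symm
  rw [h]
  exact (isLocallyConstant_ball (by omega)).comp _

theorem measurable_levelCard (r : ℕ) : Measurable fun T : PlanarTree => T.levelCard r :=
  (isLocallyConstant_levelCard r).continuous.measurable

theorem exists_cylinder_subset {U : Set PlanarTree} {T : PlanarTree} (hU : U ∈ 𝓝 T) :
    ∃ r, 1 ≤ r ∧ (T.ball r).cylinder r ⊆ U := by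
  obtain ⟨ε, hε, hsub⟩ := Metric.mem_nhds_iff.mp hU
  obtain ⟨n, hn⟩ := exists_nat_one_div_lt hε
  refine ⟨n + 1, by omega, fun T' hT' => hsub ?_⟩
  rw [Metric.mem_ball]
  refine (dist_le_of_ball_eq (by omega) hT').trans_lt ?_
  push_cast
  exact hn

/-- There are countably many finite trees. -/
theorem countable_iUnion_ofSize : (⋃ N, ofSize N).Countable :=
  Set.countable_iUnion fun N => (finite_ofSize N).countable

theorem mem_ofSize_edgesUpTo {T : PlanarTree} {r : ℕ} (hr : 1 ≤ r) (hT : T.ball r = T) :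
    T ∈ ofSize (T.edgesUpTo r) :=
  T.size_eq_edgesUpTo ((T.ball_eq_self_iff hr).mp hT)

theorem countable_ballTree {r : ℕ} (hr : 1 ≤ r) : Countable (BallTree r) :=
  (countable_iUnion_ofSize.mono fun _ hT =>
    Set.mem_iUnion.mpr ⟨_, mem_ofSize_edgesUpTo hr hT⟩).to_subtype

instance : SecondCountableTopology PlanarTree := by
  have : TopologicalSpace.SeparableSpace PlanarTree := by
    refine ⟨⋃ N, ofSize N, countable_iUnion_ofSize, fun T => ?_⟩
    rw [mem_closure_iff_nhds]
    intro U hU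
    obtain ⟨r, hr, hsub⟩ := exists_cylinder_subset hU
    have hb : (T.ball r).ball r = T.ball r := T.ball_ball le_rfl
    exact ⟨T.ball r, hsub hb, Set.mem_iUnion.mpr ⟨_, mem_ofSize_edgesUpTo hr hb⟩⟩
  exact UniformSpace.secondCountable_of_separable PlanarTree

/-- Two cylinders are nested or disjoint, as balls of smaller radius are determined by larger ones.
-/
theorem isPiSystem_cylinder :
    IsPiSystem {s : Set PlanarTree | ∃ (r : ℕ) (T₀ : PlanarTree), 1 ≤ r ∧ T₀.ball r = T₀ ∧
      s = T₀.cylinder r} := by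
  have key : ∀ (r r' : ℕ) (T T' : PlanarTree), r ≤ r' → (T.cylinder r ∩ T'.cylinder r').Nonempty →
      T.cylinder r ∩ T'.cylinder r' = T'.cylinder r' := by
    rintro r r' T T' hrr ⟨S, hS, hS'⟩
    refine Set.inter_eq_self_of_subset_right fun S' (h : S'.ball r' = T') => ?_
    exact (ball_eq_of_le hrr (h.trans (Eq.symm hS'))).trans hS
  rintro _ ⟨r, T, hr, hT, rfl⟩ _ ⟨r', T', hr', hT', rfl⟩ hne
  rcases le_total r r' with h | h
  · rw [key r r' T T' h hne]
    exact ⟨r', T', hr', hT', rfl⟩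
  · rw [Set.inter_comm] at hne ⊢
    rw [key r' r T' T h hne]
    exact ⟨r, T, hr, hT, rfl⟩

theorem exists_forall_ball_eq (t : ℕ → PlanarTree)
    (ht : ∀ r s, 1 ≤ r → r ≤ s → (t s).ball r = t r) : ∃ T : PlanarTree, ∀ r, 1 ≤ r → T.ball r = t r := by
  have hlev : ∀ r s, 1 ≤ r → s ≤ r → (t r).levelCard s = (t (s + 1)).levelCard s := by
    intro r s hr hs
    have h1 : ((t (max r (s + 1))).ball r).levelCard s =
        ((t (max r (s + 1))).ball (s + 1)).levelCard s := by
      rw [levelCard_ball _ hs, levelCard_ball _ (by omega)]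
    rwa [ht r _ hr (le_max_left _ _), ht (s + 1) _ (by omega) (le_max_right _ _)] at h1
  have hpar : ∀ r s, s < r → (t r).parent s = (t (s + 1)).parent s := by
    intro r s hs
    funext i
    rw [← ht (s + 1) r (by omega) hs, parent_ball _ (by omega)]
  let T : PlanarTree :=
    { levelCard := fun s => (t (s + 1)).levelCard s
      parent := fun s => (t (s + 1)).parent s
      levelCard_zero := levelCard_zero _
      levelCard_one := levelCard_one _
      parent_lt := fun s i h => by
        rw [← hlev (s + 1) (s + 1) (by omega) le_rfl] at h
        exact (t (s + 1)).parent_lt s i h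
      parent_mono := fun s i j hij h => by
        rw [← hlev (s + 1) (s + 1) (by omega) le_rfl] at h
        exact (t (s + 1)).parent_mono s i j hij h
      parent_outside := fun s i h => by
        rw [← hlev (s + 1) (s + 1) (by omega) le_rfl] at h
        exact (t (s + 1)).parent_outside s i h }
  refine ⟨T, fun r hr => ?_⟩
  have hm : max r 1 = r := max_eq_left hr
  have h1 : (t r).ball r = t r := ht r r hr le_rfl
  rw [← h1]
  ext s i
  · simp only [ball, hm, T]
    split_ifs with hs
    · exact (hlev r s hr hs).symm
    · rfl
  · simp only [ball, hm, T]
    split_ifs with hs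
    · rw [hpar r s hs]
    · rfl

/-- Bounded levels leave finitely many possible `r`-balls, so an ultrafilter selects one for each
`r`. The selections are compatible and glue to a tree, its limit. -/
theorem isCompact_levelCard_le (c : ℕ → ℕ) :
    IsCompact {T : PlanarTree | ∀ r, T.levelCard r ≤ c r} := by
  rw [isCompact_iff_ultrafilter_le_nhds]
  intro f hf
  have hK : {T : PlanarTree | ∀ r, T.levelCard r ≤ c r} ∈ f := le_principal_iff.mp hf
  have hex : ∀ r, ∃ S : PlanarTree, 1 ≤ r → S.cylinder r ∈ f := by
    intro r
    rcases Nat.eq_zero_or_pos r with rfl | hr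
    · exact ⟨path 1, fun h => absurd h (by omega)⟩
    · have hfin : (⋃ N ∈ Finset.range (∑ s ∈ Finset.range r, c (s + 1) + 1), ofSize N).Finite :=
        Set.Finite.biUnion (Finset.finite_toSet _) fun N _ => finite_ofSize N
      have hcov : (⋃ S ∈ ⋃ N ∈ Finset.range (∑ s ∈ Finset.range r, c (s + 1) + 1), ofSize N,
          cylinder S r) ∈ f := by
        refine mem_of_superset hK fun T hT => ?_
        refine Set.mem_biUnion (x := T.ball r) ?_ (rfl : T.ball r = T.ball r)
        refine Set.mem_biUnion (x := (T.ball r).edgesUpTo r) ?_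
          (mem_ofSize_edgesUpTo hr (T.ball_ball le_rfl))
        refine Finset.mem_coe.mpr (Finset.mem_range.mpr (Nat.lt_succ_of_le ?_))
        refine Finset.sum_le_sum fun s hs => ?_
        rw [levelCard_ball _ (by have := Finset.mem_range.mp hs; omega)]
        exact hT _
      obtain ⟨S, _, hS⟩ := (Ultrafilter.finite_biUnion_mem_iff hfin).mp hcov
      exact ⟨S, fun _ => hS⟩
  choose t ht using hex
  obtain ⟨T, hT⟩ := exists_forall_ball_eq t fun r s hr hrs => by
    obtain ⟨S, h1, h2⟩ := f.nonempty_of_mem (inter_mem (ht r hr) (ht s (hr.trans hrs)))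
    rw [← show S.ball r = t r from h1, ← show S.ball s = t s from h2, ball_ball _ hrs]
  refine ⟨T, fun r => ?_, fun U hU => ?_⟩
  · obtain ⟨S, h1, h2⟩ := f.nonempty_of_mem (inter_mem (ht (r + 1) (by omega)) hK)
    rw [← levelCard_ball T (show r ≤ r + 1 by omega), hT _ (by omega),
      ← show S.ball (r + 1) = t (r + 1) from h1, levelCard_ball _ (by omega)]
    exact h2 r
  · obtain ⟨r, hr, hsub⟩ := exists_cylinder_subset hU
    refine mem_of_superset ?_ hsub
    rw [hT r hr]
    exact ht r hr

/-! ### Tightness and weak convergence. -/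

theorem finiteSizeLaw_cylinder (μ : ℝ) (N : ℕ+) (T₀ : PlanarTree) {r : ℕ} (hr : 1 ≤ r) :
    (finiteSizeLaw μ N : Measure PlanarTree) (T₀.cylinder r) =
      ENNReal.ofReal (cylinderWeight μ N T₀ r / partitionFunction μ N) := by
  classical
  have hZ := partitionFunction_pos μ N.pos
  change finiteSizeMeasure μ N (T₀.cylinder r) = _
  simp only [finiteSizeMeasure, Measure.coe_finsetSum, Finset.sum_apply, Measure.smul_apply,
    Measure.dirac_apply' _ (isClopen_cylinder T₀ hr).isOpen.measurableSet, smul_eq_mul]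
  have hw : ∀ T, 0 ≤ weight μ T / partitionFunction μ N := fun T =>
    div_nonneg (show 0 ≤ weight μ T from (Real.exp_pos _).le) hZ.le
  rw [cylinderWeight, Finset.sum_div, ENNReal.ofReal_sum_of_nonneg fun T _ => hw T,
    Finset.sum_filter]
  refine Finset.sum_congr rfl fun T _ => ?_
  by_cases h : T.ball r = T₀
  · rw [if_pos h, Set.indicator_of_mem (show T ∈ T₀.cylinder r from h), Pi.one_apply, mul_one]
  · rw [if_neg h, Set.indicator_of_notMem (show T ∉ T₀.cylinder r from h), mul_zero]

theorem finiteSizeLaw_levelCard_lt (μ : ℝ) (N : ℕ+) {r c : ℕ} (hr : 1 ≤ r) (hc : (N : ℕ) ≤ c) :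
    (finiteSizeLaw μ N : Measure PlanarTree) {T | c < T.levelCard r} = 0 := by
  change finiteSizeMeasure μ N {T | c < T.levelCard r} = _
  have hm : MeasurableSet {T : PlanarTree | c < T.levelCard r} :=
    measurableSet_lt measurable_const (measurable_levelCard r)
  simp only [finiteSizeMeasure, Measure.coe_finsetSum, Finset.sum_apply, Measure.smul_apply,
    Measure.dirac_apply' _ hm, smul_eq_mul]
  refine Finset.sum_eq_zero fun T hT => ?_
  rw [Set.Finite.mem_toFinset] at hT
  rw [Set.indicator_of_notMem, mul_zero]
  obtain ⟨s, rfl⟩ := Nat.exists_eq_add_of_le' hr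
  have := levelCard_le_of_mem hT s
  rw [Set.mem_ofPred_eq]
  omega

theorem tendsto_finiteSizeLaw_cylinder {μ : ℝ} (hμ : 0 < μ) {T₀ : PlanarTree} {r : ℕ}
    (hr : 1 ≤ r) (hT : T₀.ball r = T₀) :
    Tendsto (fun N : ℕ+ => (finiteSizeLaw μ N : Measure PlanarTree) (T₀.cylinder r)) atTop
      (𝓝 (ENNReal.ofReal (cylinderLimit μ T₀ r))) := by
  simp only [finiteSizeLaw_cylinder μ _ T₀ hr]
  exact (ENNReal.tendsto_ofReal (tendsto_cylinderWeight_div hμ hr hT)).comp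
    tendsto_PNat_val_atTop_atTop

/-- The limiting cylinder probabilities sum to `1`, so finitely many cylinders carry mass above `1 -
δ` for all large `N`. For the remaining `N ≤ N₀` the level size is at most `N₀`. -/
theorem exists_levelCard_bound {μ : ℝ} (hμ : 0 < μ) {r : ℕ} (hr : 1 ≤ r) {δ : ℝ≥0∞} (hδ : 0 < δ) :
    ∃ c : ℕ, ∀ N : ℕ+, (finiteSizeLaw μ N : Measure PlanarTree) {T | c < T.levelCard r} ≤ δ := by
  obtain ⟨R, rfl⟩ := Nat.exists_eq_add_of_le' hr
  rcases le_or_gt 1 δ with h1δ | hδ1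
  · exact ⟨0, fun N => prob_le_one.trans h1δ⟩
  have hsum : HasSum (fun T : BallTree (R + 1) => ENNReal.ofReal (cylinderLimit μ T.1 (R + 1))) 1 := by
    rw [← tsum_cylinderLimit hμ R]
    exact ENNReal.summable.hasSum
  have hlt : 1 - δ < 1 := ENNReal.sub_lt_self ENNReal.one_ne_top one_ne_zero hδ.ne'
  obtain ⟨F, hF⟩ := (hsum.eventually (lt_mem_nhds hlt)).exists
  have htend := tendsto_finsetSum F fun T _ =>
    tendsto_finiteSizeLaw_cylinder hμ hr T.2
  obtain ⟨N₀, hN₀⟩ := eventually_atTop.mp (htend.eventually (lt_mem_nhds hF))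
  refine ⟨max (F.sup fun T => T.1.levelCard (R + 1)) N₀, fun N => ?_⟩
  rcases le_or_gt N N₀ with hN | hN
  · rw [finiteSizeLaw_levelCard_lt μ N hr (le_trans (by exact_mod_cast hN) (le_max_right _ _))]
    exact zero_le
  · set P := (finiteSizeLaw μ N : Measure PlanarTree) with hP
    have hmeas : MeasurableSet (⋃ T ∈ F, cylinder T.1 (R + 1)) :=
      Finset.measurableSet_biUnion _ fun T _ => (isClopen_cylinder T.1 hr).isOpen.measurableSet
    have hunion : P (⋃ T ∈ F, cylinder T.1 (R + 1)) = ∑ T ∈ F, P (cylinder T.1 (R + 1)) := by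
      refine measure_biUnion_finset ?_ fun T _ => (isClopen_cylinder T.1 hr).isOpen.measurableSet
      intro T _ T' _ hne
      refine Set.disjoint_left.mpr fun S h1 h2 => hne (Subtype.ext ?_)
      exact (show S.ball (R + 1) = T.1 from h1).symm.trans h2
    have hsub : {T : PlanarTree | max (F.sup fun T => T.1.levelCard (R + 1)) N₀ <
        T.levelCard (R + 1)} ⊆ (⋃ T ∈ F, cylinder T.1 (R + 1))ᶜ := by
      intro S hS hmem
      simp only [Set.mem_iUnion] at hmem
      obtain ⟨T, hTF, hST⟩ := hmem
      have h1 : T.1.levelCard (R + 1) ≤ F.sup fun T => T.1.levelCard (R + 1) :=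
        Finset.le_sup (f := fun T : BallTree (R + 1) => T.1.levelCard (R + 1)) hTF
      rw [← show S.ball (R + 1) = T.1 from hST, levelCard_ball _ le_rfl] at h1
      have h2 : max (F.sup fun T => T.1.levelCard (R + 1)) (N₀ : ℕ) < S.levelCard (R + 1) := hS
      have h3 := le_max_left (F.sup fun T => T.1.levelCard (R + 1)) (N₀ : ℕ)
      omega
    refine (measure_mono hsub).trans ?_
    rw [prob_compl_eq_one_sub hmeas, hunion]
    have h3 := (hN₀ N hN.le).le
    rw [tsub_le_iff_left] at h3 ⊢
    rwa [add_comm]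

theorem isTightMeasureSet_finiteSizeLaw {μ : ℝ} (hμ : 0 < μ) :
    IsTightMeasureSet {((P : ProbabilityMeasure PlanarTree) : Measure PlanarTree) |
      P ∈ Set.range (finiteSizeLaw μ)} := by
  rw [isTightMeasureSet_iff_exists_isCompact_measure_compl_le]
  intro ε hε
  obtain ⟨δ, hδ, hsum⟩ := ENNReal.exists_pos_sum_of_countable hε.ne' ℕ
  have hex : ∀ r : ℕ, ∃ c : ℕ, ∀ N : ℕ+,
      (finiteSizeLaw μ N : Measure PlanarTree) {T | c < T.levelCard r} ≤ δ r := by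
    intro r
    rcases Nat.eq_zero_or_pos r with rfl | hr
    · refine ⟨1, fun N => ?_⟩
      simp [levelCard_zero]
    · exact exists_levelCard_bound hμ hr (by exact_mod_cast hδ r)
  choose c hc using hex
  refine ⟨_, isCompact_levelCard_le c, ?_⟩
  rintro _ ⟨_, ⟨N, rfl⟩, rfl⟩
  have hcompl : {T : PlanarTree | ∀ r, T.levelCard r ≤ c r}ᶜ = ⋃ r, {T | c r < T.levelCard r} := by
    ext T
    simp
  rw [hcompl]
  exact (measure_iUnion_le _).trans ((ENNReal.tsum_le_tsum fun r => hc r N).trans hsum.le)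

/-- Prokhorov's theorem supplies a cluster point. Cylinders are clopen, so its values on them are
the known limits, and convergence on this π-system of small neighbourhoods gives weak convergence of
the whole sequence. -/
theorem exists_tendsto_finiteSizeLaw {μ : ℝ} (hμ : 0 < μ) :
    ∃ P : ProbabilityMeasure PlanarTree, Tendsto (finiteSizeLaw μ) atTop (𝓝 P) ∧
      ∀ r, 1 ≤ r → ∀ T₀ : PlanarTree, T₀.ball r = T₀ →
        (P : Measure PlanarTree) (T₀.cylinder r) = ENNReal.ofReal (cylinderLimit μ T₀ r) := by
  have hcomp := isCompact_closure_of_isTightMeasureSet (isTightMeasureSet_finiteSizeLaw hμ)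
  obtain ⟨P, -, hP⟩ := hcomp.exists_mapClusterPt (f := atTop) (u := finiteSizeLaw μ)
    (le_principal_iff.mpr (mem_map.mpr (Eventually.of_forall fun N : ℕ+ =>
      subset_closure (Set.mem_range_self N))))
  have hcyl : ∀ r, 1 ≤ r → ∀ T₀ : PlanarTree, T₀.ball r = T₀ →
      (P : Measure PlanarTree) (T₀.cylinder r) = ENNReal.ofReal (cylinderLimit μ T₀ r) := by
    intro r hr T₀ hT
    have h1 : Tendsto (fun Q : ProbabilityMeasure PlanarTree =>
        (Q : Measure PlanarTree) (T₀.cylinder r)) (𝓝 P)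
        (𝓝 ((P : Measure PlanarTree) (T₀.cylinder r))) :=
      ProbabilityMeasure.tendsto_measure_of_null_frontier_of_tendsto' tendsto_id
        (by simp [(isClopen_cylinder T₀ hr).frontier_eq])
    have h2 := hP.tendsto_comp h1
    have h3 := tendsto_finiteSizeLaw_cylinder hμ hr hT
    exact eq_of_nhds_neBot (ClusterPt.mono h2 h3)
  refine ⟨P, isPiSystem_cylinder.tendsto_probabilityMeasure_of_tendsto_of_mem ?_ ?_ ?_, hcyl⟩
  · rintro _ ⟨r, T₀, hr, -, rfl⟩
    exact (isClopen_cylinder T₀ hr).isOpen.measurableSet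
  · intro U hU T hT
    obtain ⟨r, hr, hsub⟩ := exists_cylinder_subset (hU.mem_nhds hT)
    exact ⟨_, ⟨r, T.ball r, hr, T.ball_ball le_rfl, rfl⟩,
      (isClopen_cylinder _ hr).isOpen.mem_nhds rfl, hsub⟩
  · rintro _ ⟨r, T₀, hr, hT, rfl⟩
    have h3 := tendsto_finiteSizeLaw_cylinder hμ hr hT
    rw [← hcyl r hr T₀ hT] at h3
    exact (ENNReal.tendsto_toNNReal (measure_ne_top _ _)).comp h3

/-! ### Moments of the limit measure and the asymptotic formulas. -/

theorem lintegral_levelCard {μ : ℝ} (hμ : 0 < μ) {P : ProbabilityMeasure PlanarTree}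
    (hP : ∀ r, 1 ≤ r → ∀ T₀ : PlanarTree, T₀.ball r = T₀ →
      (P : Measure PlanarTree) (T₀.cylinder r) = ENNReal.ofReal (cylinderLimit μ T₀ r)) (R : ℕ) :
    ∫⁻ T : PlanarTree, (T.levelCard (R + 1) : ℝ≥0∞) ∂(P : Measure PlanarTree) =
      ENNReal.ofReal (1 + 2 * R + μ * R * (R + 1)) := by
  have hr : 1 ≤ R + 1 := by omega
  have hcount := countable_ballTree hr
  let b : PlanarTree → BallTree (R + 1) := fun T => ⟨T.ball (R + 1), T.ball_ball le_rfl⟩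
  have hfib : ∀ T : BallTree (R + 1), b ⁻¹' {T} = cylinder T.1 (R + 1) := by
    intro T
    ext S
    exact Subtype.ext_iff
  have hb : Measurable b := measurable_to_countable' fun T => by
    rw [hfib]
    exact (isClopen_cylinder T.1 hr).isOpen.measurableSet
  have h1 : ∀ T : PlanarTree, (T.levelCard (R + 1) : ℝ≥0∞) =
      (fun S : BallTree (R + 1) => (S.1.levelCard (R + 1) : ℝ≥0∞)) (b T) := by
    intro T
    simp only [b]
    rw [levelCard_ball _ le_rfl]
  -- The level size depends only on the ball, so the integral is pushed forward to the countable set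
  -- of balls, whose fibres are cylinders.
  rw [lintegral_congr h1, 
    ← lintegral_map (f := fun S : BallTree (R + 1) => (S.1.levelCard (R + 1) : ℝ≥0∞))
      (measurable_of_countable _) hb, lintegral_countable',
    ← tsum_cylinderLimit_mul_levelCard hμ R]
  refine tsum_congr fun T => ?_
  rw [Measure.map_apply hb (measurableSet_singleton T), hfib, hP _ hr _ T.2, mul_comm]

theorem integral_levelCard {μ : ℝ} (hμ : 0 < μ) {P : ProbabilityMeasure PlanarTree}
    (hP : ∀ r, 1 ≤ r → ∀ T₀ : PlanarTree, T₀.ball r = T₀ →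
      (P : Measure PlanarTree) (T₀.cylinder r) = ENNReal.ofReal (cylinderLimit μ T₀ r)) (R : ℕ) :
    Integrable (fun T : PlanarTree => (T.levelCard (R + 1) : ℝ)) (P : Measure PlanarTree) ∧
    ∫ T : PlanarTree, (T.levelCard (R + 1) : ℝ) ∂(P : Measure PlanarTree) =
      1 + 2 * R + μ * R * (R + 1) := by
  have h1 := lintegral_levelCard hμ hP R
  have hm : AEStronglyMeasurable (fun T : PlanarTree => (T.levelCard (R + 1) : ℝ))
      (P : Measure PlanarTree) :=
    (measurable_from_top.comp (measurable_levelCard (R + 1))).aestronglyMeasurable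
  have h2 : ∫⁻ T : PlanarTree, ENNReal.ofReal (T.levelCard (R + 1) : ℝ) ∂(P : Measure PlanarTree) =
      ENNReal.ofReal (1 + 2 * R + μ * R * (R + 1)) := by
    rw [← h1]
    exact lintegral_congr fun T => ENNReal.ofReal_natCast _
  have hnn : ∀ T : PlanarTree, (0 : ℝ) ≤ (T.levelCard (R + 1) : ℝ) := fun T => Nat.cast_nonneg _
  refine ⟨⟨hm, ?_⟩, ?_⟩
  · rw [hasFiniteIntegral_iff_ofReal (Eventually.of_forall hnn), h2]
    exact ENNReal.ofReal_lt_top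
  · rw [integral_eq_lintegral_of_nonneg_ae (Eventually.of_forall hnn) hm, h2,
      ENNReal.toReal_ofReal (by positivity)]

theorem toNat_size_ball (T : PlanarTree) {r : ℕ} (hr : 1 ≤ r) :
    ((T.ball r).size.toNat : ℝ) = ∑ s ∈ Finset.range r, (T.levelCard (s + 1) : ℝ) := by
  rw [(T.ball r).size_eq_edgesUpTo (((T.ball r).ball_eq_self_iff hr).mp (T.ball_ball le_rfl)),
    ENat.toNat_natCast, edgesUpTo, Nat.cast_sum]
  refine Finset.sum_congr rfl fun s hs => ?_
  rw [levelCard_ball _ (Finset.mem_range.mp hs)]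

theorem sum_levelCard_mean (μ : ℝ) (r : ℕ) :
    ∑ s ∈ Finset.range r, (1 + 2 * (s : ℝ) + μ * s * (s + 1)) =
      (r : ℝ) ^ 2 + μ / 3 * ((r : ℝ) ^ 3 - r) := by
  induction r with
  | zero => simp
  | succ r ih => rw [Finset.sum_range_succ, ih]; push_cast; ring

end PlanarTree

theorem mainTheorem11 (μ : ℝ) (hμ : 0 < μ) :
    Tendsto (PlanarTree.finiteSizeLaw μ) atTop (𝓝 (PlanarTree.localLimit μ)) ∧
    (∀ r : ℕ, 1 ≤ r → Integrable (fun T : PlanarTree => (T.levelCard r : ℝ))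
      (PlanarTree.localLimit μ : Measure PlanarTree)) ∧
    (∀ r : ℕ, 1 ≤ r → Integrable (fun T : PlanarTree => ((T.ball r).size.toNat : ℝ))
      (PlanarTree.localLimit μ : Measure PlanarTree)) ∧
    (∃ ε : ℕ → ℝ, ε =O[atTop] (fun r : ℕ => 1 / (r : ℝ)) ∧
      ∀ r : ℕ, 1 ≤ r →
        ∫ T : PlanarTree, (T.levelCard r : ℝ) ∂(PlanarTree.localLimit μ : Measure PlanarTree) =
          μ * (r : ℝ) ^ 2 * (1 + ε r)) ∧
    (∃ ε : ℕ → ℝ, ε =O[atTop] (fun r : ℕ => 1 / (r : ℝ)) ∧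
      ∀ r : ℕ, 1 ≤ r →
        ∫ T : PlanarTree, ((T.ball r).size.toNat : ℝ)
            ∂(PlanarTree.localLimit μ : Measure PlanarTree) =
          1 / 3 * μ * (r : ℝ) ^ 3 * (1 + ε r)) := by
  obtain ⟨P, hlim, hP⟩ := PlanarTree.exists_tendsto_finiteSizeLaw hμ
  have hPeq : PlanarTree.localLimit μ = P := hlim.limUnder_eq
  rw [hPeq]
  have hI := fun R => PlanarTree.integral_levelCard hμ hP R
  have hball : ∀ r : ℕ, 1 ≤ r → (fun T : PlanarTree => ((T.ball r).size.toNat : ℝ)) =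
      fun T => ∑ s ∈ Finset.range r, (T.levelCard (s + 1) : ℝ) := fun r hr =>
    funext fun T => T.toNat_size_ball hr
  have hO : ∀ (a b : ℝ), (fun r : ℕ => a / (r : ℝ) + b / (r : ℝ) ^ 2) =O[atTop]
      fun r : ℕ => 1 / (r : ℝ) := by
    intro a b
    refine IsBigO.of_bound (|a| + |b|) ?_
    filter_upwards [eventually_ge_atTop 1] with r hr
    have hr1 : (1 : ℝ) ≤ r := by exact_mod_cast hr
    have hr0 : (0 : ℝ) < r := by linarith
    rw [Real.norm_eq_abs, Real.norm_eq_abs, abs_of_pos (show (0 : ℝ) < 1 / r by positivity)]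
    calc |a / (r : ℝ) + b / (r : ℝ) ^ 2| ≤ |a / (r : ℝ)| + |b / (r : ℝ) ^ 2| := abs_add_le _ _
      _ = |a| / r + |b| / (r : ℝ) ^ 2 := by
        rw [abs_div, abs_div, abs_of_pos hr0, abs_of_pos (pow_pos hr0 2)]
      _ ≤ |a| / r + |b| / r := by
        gcongr
        nlinarith
      _ = _ := by ring
  -- The relative errors are exact: the means are `μ r ^ 2 + (2 - μ) r - 1` and `μ r ^ 3 / 3 + r ^ 2
  -- - μ r / 3`, divided by their leading terms.
  refine ⟨hlim, ?_, ?_, ⟨_, hO ((2 - μ) / μ) (-1 / μ), ?_⟩, ⟨_, hO (3 / μ) (-1), ?_⟩⟩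
  · intro r hr
    obtain ⟨R, rfl⟩ := Nat.exists_eq_add_of_le' hr
    exact (hI R).1
  · intro r hr
    rw [hball r hr]
    exact integrable_finsetSum _ fun s _ => (hI s).1
  · intro r hr
    obtain ⟨R, rfl⟩ := Nat.exists_eq_add_of_le' hr
    rw [(hI R).2]
    push_cast
    have : (R : ℝ) + 1 ≠ 0 := by positivity
    field_simp
    ring
  · intro r hr
    rw [hball r hr, integral_finsetSum _ fun s _ => (hI s).1,
      Finset.sum_congr rfl fun s _ => (hI s).2, PlanarTree.sum_levelCard_mean]
    have : (r : ℝ) ≠ 0 := by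
      have : (0 : ℝ) < r := by exact_mod_cast hr
      exact this.ne'
    field_simp
    ring
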